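/- **Setting.** The correspondence language is first-order logic without identity over the binary predicate letters $R_1,R_2,\dots$ and the unary predicate letters $P_1,P_2,\dots$. Let $\Theta$ be a set of these letters containing all $R_i$. A $\Theta$-formula uses only letters of $\Theta$, a $\Theta$-model is a (non-empty) first-order structure for $\Theta$ with domain $U$, and $\varphi(x)$ indicates that at most $x$ is free in $\varphi$. For a sequence $S=(S_1,\dots,S_m)$ of letters $R_i$ with $m\ge 1$ write $\pi_S(x_1,\dots,x_{m+1})$ for $\bigwedge_{i=1}^m S_i(x_i,x_{i+1})$, and call a sequence of elements of a model satisfying it an $S$-path. **Guarded connectives.** A $k$-ary guarded connective of degree $0$ is a Boolean combination of $P_1(x),\dots,P_k(x)$ ($\top$ and $\bot$ being allowed as nullary ones). If $\mu^-$ is a $k$-ary guarded connective of degree $n$ that is not $\forall$-guarded, then $\mu=\forall x_2\ldots x_{m+1}(\pi_S(x_1,\dots,x_{m+1})\to\mu^-(x_{m+1}))$, with $x_1=x$, is a $\forall$-guarded $k$-ary guarded connective of degree $\delta(\mu)=n+1$, provided it is not logically equivalent to a $k$-ary guarded connective of smaller degree; dually, if $\mu^-$ is not $\exists$-guarded, $\mu=\exists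 x_2\ldots x_{m+1}(\pi_S(x_1,\dots,x_{m+1})\wedge\mu^-(x_{m+1}))$ is $\exists$-guarded of degree $n+1$ under the same proviso. The Boolean function $f$ defined by the innermost Boolean combination is the propositional core of $\mu$. Logically equivalent connectives of the same arity count as the same. The application $\mu(\psi_1,\dots,\psi_k)$ is obtained by replacing each $P_i(w)$ in $\mu$ by $\psi_i(w)$. Order $\{0,1\}^k$ coordinatewise. A Boolean function is a rest function if it is neither monotone nor anti-monotone; it is TFT (resp. FTF) if there are $a<b<c$ on which it takes the values $1,0,1$ (resp. $0,1,0$). It is weakly $\forall$-special if it is not TFT, weakly $\exists$-special if it is not FTF, and $Q$-special if it is a weakly $Q$-special rest function. A guarded connective of degree $1$ with quantifier $Q\in\{\forall,\exists\}$ is (weakly) special if its core is (weakly) $Q$-special. A guarded connective $\mu$ of degree $2$ is regular if $\mu^-$ is weakly special and the core of $\mu$ is not constant. **Fragments.** For a set $\mathbb M$ of guarded connectives, $\mathcal L^\Theta_x(\mathbb M)$ is the least set of formulas containing $P_n(x)$ for all $P_n\in\Theta$ and closed under application of the members of $\mathbb M$. It is standard if $\mathbb M$ is finite and each member of $\mathbb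 M$ has degree at most $1$ or is regular of degree $2$. **Asimulations.** Let $M_1,M_2$ be $\Theta$-models with domains $U_1,U_2$ (taken to be disjoint), and let $W$ be the set of all relations $A\subseteq(U_1\times U_2)\cup(U_2\times U_1)$. A formula $\varphi(x)$ is invariant with respect to $A\in W$ if $a\mathrel A b$ and the truth of $\varphi$ at $a$ imply the truth of $\varphi$ at $b$ (for pairs in either direction); it is invariant with respect to a class of such relations if it is so with respect to each of them. For $\beta\subseteq W$ define sets $[\mu](\beta)$ of $(\delta(\mu)+1)$-tuples of elements of $W$: * if $\delta(\mu)=0$ and $f$ is the core of $\mu$, then $[\mu](\beta)$ is $W$ if $f$ is constant, $\beta$ if $f$ is non-constant monotone, $\{B^{-1}\mid B\in\beta\}$ if $f$ is non-constant anti-monotone, and $\{B\cap B^{-1}\mid B\in\beta\}$ otherwise; * if $\mu$ is guarded and not special, then $\langle A_1,\dots,A_{\delta(\mu)+1}\rangle\in[\mu](\beta)$ iff $\langle A_1,\dots,A_{\delta(\mu)}\rangle\in[\mu^-](\beta)$ and, writing $A=A_{\delta(\mu)+1}$ and $B=A_{\delta(\mu)}$, for both choices of $(r,t)$ with $\{r,t\}=\{1,2\}$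 the following holds. If $\mu$ is $\forall$-guarded: whenever $a_1\in U_r$, $(b_1,\dots,b_{m+1})$ is an $S$-path in $M_t$ and $a_1\mathrel A b_1$, there is an $S$-path $(a_1,\dots,a_{m+1})$ in $M_r$ with $a_{m+1}\mathrel B b_{m+1}$. If $\mu$ is $\exists$-guarded: whenever $(a_1,\dots,a_{m+1})$ is an $S$-path in $M_r$, $b_1\in U_t$ and $a_1\mathrel A b_1$, there is an $S$-path $(b_1,\dots,b_{m+1})$ in $M_t$ with $a_{m+1}\mathrel B b_{m+1}$; * if $\mu$ is special, then $\langle B,A\rangle\in[\mu](\beta)$ iff $B\in\beta$, $A\in W$, and the condition of the previous item (for the quantifier of $\mu$) holds both for $(A,B)$ and for $(A,B^{-1})$. A non-empty $A\in W$ is an $\mathcal L^\Theta_x(\mathbb M)$-asimulation between $M_1$ and $M_2$ if every $P_n(x)$ with $P_n\in\Theta$ is invariant with respect to $A$, and for every $\mu\in\mathbb M$ there are $A_1,\dots,A_{\delta(\mu)}\in W$ with $\langle A_1,\dots,A_{\delta(\mu)},A\rangle\in[\mu](\{A\})$. **Theorem.** Let $\mathcal L^\Theta_x(\mathbb M)$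 be a standard fragment with $\{\wedge,\vee,\bot,\top\}\subseteq\mathbb M$, where $\bot$ and $\top$ are taken as nullary connectives, and let $\varphi(x)$ be a $\Theta$-formula of the correspondence language. Then $\varphi(x)$ is logically equivalent to a formula of $\mathcal L^\Theta_x(\mathbb M)$ if and only if $\varphi(x)$ is invariant with respect to all $\mathcal L^\Theta_x(\mathbb M)$-asimulations, between any two $\Theta$-models. -/

import Mathlib

/-- Predicate letters of the vocabulary: binary letters `R i` for all `i : ℕ`, and unary
letters `P n` for `n ∈ Θ`. A set `Θ` of indices thus stands for the vocabulary that has all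
the binary letters and the unary letters `P n`, `n ∈ Θ`; `Set.univ` gives the full one. -/
inductive CorrRel (Θ : Set ℕ) : ℕ → Type
  | P (n : Θ) : CorrRel Θ 1
  | R (i : ℕ) : CorrRel Θ 2

/-- The correspondence language over `Θ` (no constants, no function symbols). -/
def corrLang (Θ : Set ℕ) : FirstOrder.Language.{0, 0} := ⟨fun _ => Empty, CorrRel Θ⟩

/-- The letter `P n` as a symbol of the language. -/
def symP {Θ : Set ℕ} (n : Θ) : (corrLang Θ).Relations 1 := CorrRel.P n

/-- The letter `R i` as a symbol of the language. -/
def symR {Θ : Set ℕ} (i : ℕ) : (corrLang Θ).Relations 2 := CorrRel.R i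

/-- Formulas `φ(x)` over `Θ` with at most one free variable. -/
abbrev CorrFormula (Θ : Set ℕ) := (corrLang Θ).Formula Unit

/-- The identity symbol does not occur in the formula. -/
def IdentityFree {L : FirstOrder.Language.{0, 0}} {α : Type} : {n : ℕ} → L.BoundedFormula α n → Prop
  | _, .falsum => True
  | _, .equal _ _ => False
  | _, .rel _ _ => True
  | _, .imp φ ψ => IdentityFree φ ∧ IdentityFree ψ
  | _, .all φ => IdentityFree φ

/-- The atomic formula `P n (x)`. -/
def atomP {Θ : Set ℕ} (n : Θ) : CorrFormula Θ :=
  FirstOrder.Language.Relations.formula₁ (symP n) (FirstOrder.Language.Term.var ())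

/-- Truth of `φ(x)` at a pointed model `(M, a)`. -/
def TrueAt {Θ : Set ℕ} {U : Type*} [(corrLang Θ).Structure U] (a : U) (φ : CorrFormula Θ) :
    Prop :=
  φ.Realize (fun _ => a)

/-! ### Boolean functions -/

/-- Boolean combinations of the `k` atoms `P 0 (x), …, P (k - 1) (x)`. -/
inductive BoolComb (k : ℕ) : Type
  | atom (i : Fin k) : BoolComb k
  | top : BoolComb k
  | bot : BoolComb k
  | neg (b : BoolComb k) : BoolComb k
  | and (b c : BoolComb k) : BoolComb k
  | or (b c : BoolComb k) : BoolComb k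

namespace BoolComb

/-- The Boolean function defined by a Boolean combination. -/
def eval {k : ℕ} : BoolComb k → (Fin k → Bool) → Bool
  | atom i, v => v i
  | top, _ => true
  | bot, _ => false
  | neg b, v => !(b.eval v)
  | and b c, v => b.eval v && c.eval v
  | or b c, v => b.eval v || c.eval v

/-- Replace the `i`-th atom by the formula `ψ i`. -/
def apply {Θ : Set ℕ} {k : ℕ} : BoolComb k → (Fin k → CorrFormula Θ) → CorrFormula Θ
  | atom i, ψ => ψ i
  | top, _ => ⊤
  | bot, _ => ⊥
  | neg b, ψ => (b.apply ψ).not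
  | and b c, ψ => b.apply ψ ⊓ c.apply ψ
  | or b c, ψ => b.apply ψ ⊔ c.apply ψ

end BoolComb

def IsConstantFn {k : ℕ} (f : (Fin k → Bool) → Bool) : Prop := ∀ a b, f a = f b

/-- Neither monotone nor anti-monotone (tuples are ordered coordinatewise, `false < true`). -/
def IsRest {k : ℕ} (f : (Fin k → Bool) → Bool) : Prop := ¬ Monotone f ∧ ¬ Antitone f

def IsTFT {k : ℕ} (f : (Fin k → Bool) → Bool) : Prop :=
  ∃ a b c, a < b ∧ b < c ∧ f a = true ∧ f b = false ∧ f c = true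

def IsFTF {k : ℕ} (f : (Fin k → Bool) → Bool) : Prop :=
  ∃ a b c, a < b ∧ b < c ∧ f a = false ∧ f b = true ∧ f c = false

inductive Quant : Type
  | all
  | ex

/-- Weakly `∀`-special: not `TFT`; weakly `∃`-special: not `FTF`. -/
def WeaklySpecialFn {k : ℕ} : Quant → ((Fin k → Bool) → Bool) → Prop
  | .all, f => ¬ IsTFT f
  | .ex, f => ¬ IsFTF f

/-- `Q`-special: a rest function that is weakly `Q`-special. -/
def SpecialFn {k : ℕ} (Q : Quant) (f : (Fin k → Bool) → Bool) : Prop :=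
  IsRest f ∧ WeaklySpecialFn Q f

/-! ### Guarded connectives -/

/-- Expressions of the shape of a `k`-ary guarded connective: a Boolean combination under a
sequence of guarded quantifier blocks. `guard Q m S μ` stands for
`∀ x₂ … x_{m+2} (S₁(x₁,x₂) ∧ … ∧ S_{m+1}(x_{m+1},x_{m+2}) → μ(x_{m+2}))` if `Q` is `∀`,
and for the dual formula with `∃` and `∧` if `Q` is `∃`. -/
inductive PreConn (k : ℕ) : Type
  | core (b : BoolComb k) : PreConn k
  | guard (Q : Quant) (m : ℕ) (S : Fin (m + 1) → ℕ) (μ : PreConn k) : PreConn k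

/-- The variables `x₁, …, x_{m+1}`: the free variable followed by `m` bound ones. -/
def pathVar {Θ : Set ℕ} (m : ℕ) : Fin (m + 1) → (corrLang Θ).Term (Unit ⊕ Fin m) :=
  Fin.cases (FirstOrder.Language.Term.var (Sum.inl ())) (fun i => FirstOrder.Language.Term.var (Sum.inr i))

/-- The conjunction `⋀ Sᵢ(xᵢ, xᵢ₊₁)`. -/
noncomputable def pathFormula {Θ : Set ℕ} {m : ℕ} (S : Fin (m + 1) → ℕ) :
    (corrLang Θ).BoundedFormula Unit (m + 1) :=
  FirstOrder.Language.BoundedFormula.iInf fun i : Fin (m + 1) =>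
    FirstOrder.Language.Relations.boundedFormula₂ (symR (S i))
      (pathVar (m + 1) i.castSucc) (pathVar (m + 1) i.succ)

/-- The formula `ψ(x_{m+2})`, as a formula in the variables `x₁, …, x_{m+2}`. -/
def atLast {Θ : Set ℕ} (m : ℕ) (ψ : CorrFormula Θ) :
    (corrLang Θ).BoundedFormula Unit (m + 1) :=
  FirstOrder.Language.BoundedFormula.relabel (n := m + 1) (k := 0) (fun _ => Sum.inr (Fin.last m)) ψ

noncomputable def guardFormula {Θ : Set ℕ} (Q : Quant) {m : ℕ} (S : Fin (m + 1) → ℕ)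
    (ψ : CorrFormula Θ) : CorrFormula Θ :=
  match Q with
  | .all => ((pathFormula S).imp (atLast m ψ)).alls
  | .ex => (pathFormula S ⊓ atLast m ψ).exs

namespace PreConn

variable {k : ℕ}

/-- The number of quantifier blocks. -/
def degree : PreConn k → ℕ
  | core _ => 0
  | guard _ _ _ μ => μ.degree + 1

def propCore : PreConn k → BoolComb k
  | core b => b
  | guard _ _ _ μ => μ.propCore

/-- `μ` is `Q`-guarded. -/
def IsGuardedBy (Q : Quant) : PreConn k → Prop
  | core _ => False
  | guard Q' _ _ _ => Q' = Q

/-- The application `μ(ψ₁, …, ψ_k)`. -/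
noncomputable def apply {Θ : Set ℕ} : PreConn k → (Fin k → CorrFormula Θ) → CorrFormula Θ
  | core b, ψ => b.apply ψ
  | guard Q _ S μ, ψ => guardFormula Q S (μ.apply ψ)

/-- `μ` as a formula of the full correspondence language. -/
noncomputable def toFormula (μ : PreConn k) : CorrFormula Set.univ :=
  μ.apply fun i => atomP ⟨i, Set.mem_univ _⟩

/-- `μ` and `ν` are logically equivalent as formulas. -/
def Equivalent {l : ℕ} (μ : PreConn k) (ν : PreConn l) : Prop :=
  (∅ : (corrLang Set.univ).Theory).Iff μ.toFormula ν.toFormula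

/-- `μ` is a `k`-ary guarded connective (of degree `μ.degree`): the quantifier blocks alternate,
and neither `μ` nor any ancestor of it is equivalent to a `k`-ary guarded connective of smaller
degree. -/
def IsGuardedConnective : PreConn k → Prop
  | core _ => True
  | guard Q m S μ =>
      μ.IsGuardedConnective ∧ ¬ μ.IsGuardedBy Q ∧
        ¬ ∃ ν : PreConn k, ∃ _ : ν.degree < μ.degree + 1,
          ν.IsGuardedConnective ∧ (guard Q m S μ).Equivalent ν
termination_by μ => μ.degree
decreasing_by
  all_goals simp only [degree]
  all_goals omega

/-- `ν` is `μ` itself or an ancestor of `μ`. -/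
def HasAncestor : PreConn k → PreConn k → Prop
  | core b, ν => ν = core b
  | guard Q m S μ, ν => ν = guard Q m S μ ∨ μ.HasAncestor ν

/-- Degree `1`, with a `Q`-special propositional core, where `Q` is the quantifier. -/
def IsSpecial : PreConn k → Prop
  | guard Q _ _ (core b) => SpecialFn Q b.eval
  | _ => False

/-- Degree `1`, with a weakly `Q`-special propositional core, where `Q` is the quantifier. -/
def IsWeaklySpecial : PreConn k → Prop
  | guard Q _ _ (core b) => WeaklySpecialFn Q b.eval
  | _ => False

def IsFlat (μ : PreConn k) : Prop := μ.degree ≤ 1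

def IsRegular (μ : PreConn k) : Prop :=
  (∃ ν, μ.HasAncestor ν ∧ ν.degree = 1 ∧ ν.IsWeaklySpecial) ∧ ¬ IsConstantFn μ.propCore.eval

end PreConn

/-- A connective together with its arity. -/
abbrev Conn := Σ k : ℕ, PreConn k

def connAnd : Conn := ⟨2, .core (.and (.atom 0) (.atom 1))⟩
def connOr : Conn := ⟨2, .core (.or (.atom 0) (.atom 1))⟩
def connTop : Conn := ⟨0, .core .top⟩
def connBot : Conn := ⟨0, .core .bot⟩

/-- `ν` belongs to `𝕄`, where equivalent connectives of the same arity count as one and the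
same. -/
def ContainsConn (𝕄 : Set Conn) (ν : Conn) : Prop :=
  ∃ μ ∈ 𝕄, μ.1 = ν.1 ∧ μ.2.Equivalent ν.2

/-- `𝕄` is a finite set of guarded connectives, each of which is flat or else regular of
degree `2`. -/
def IsStandard (𝕄 : Set Conn) : Prop :=
  𝕄.Finite ∧ ∀ μ ∈ 𝕄, μ.2.IsGuardedConnective ∧
    (μ.2.IsFlat ∨ (μ.2.IsRegular ∧ μ.2.degree = 2))

/-- The fragment generated by `𝕄` from the atoms `P n (x)`, `n ∈ Θ`. -/
inductive Fragment (Θ : Set ℕ) (𝕄 : Set Conn) : CorrFormula Θ → Prop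
  | atom (n : Θ) : Fragment Θ 𝕄 (atomP n)
  | app (μ : Conn) (hμ : μ ∈ 𝕄) (ψ : Fin μ.1 → CorrFormula Θ)
      (hψ : ∀ i, Fragment Θ 𝕄 (ψ i)) : Fragment Θ 𝕄 (μ.2.apply ψ)

/-! ### Asimulations -/

/-- A binary relation `A ⊆ (U₁ × U₂) ∪ (U₂ × U₁)`, where the domains are taken to be disjoint:
`fwd` is its part in `U₁ × U₂` and `bwd` its part in `U₂ × U₁`. -/
@[ext]
structure BiRel (U₁ U₂ : Type*) where
  fwd : U₁ → U₂ → Prop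
  bwd : U₂ → U₁ → Prop

namespace BiRel

variable {U₁ U₂ : Type*}

def inv (A : BiRel U₁ U₂) : BiRel U₁ U₂ := ⟨fun a b => A.bwd b a, fun b a => A.fwd a b⟩

def inter (A B : BiRel U₁ U₂) : BiRel U₁ U₂ :=
  ⟨fun a b => A.fwd a b ∧ B.fwd a b, fun b a => A.bwd b a ∧ B.bwd b a⟩

def IsNonempty (A : BiRel U₁ U₂) : Prop := (∃ a b, A.fwd a b) ∨ ∃ b a, A.bwd b a

end BiRel

/-- `c₁ S₁ c₂ S₂ … S_{m+1} c_{m+2}`. -/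
def IsPath (Θ : Set ℕ) {U : Type*} [(corrLang Θ).Structure U] {m : ℕ} (S : Fin (m + 1) → ℕ)
    (c : Fin (m + 2) → U) : Prop :=
  ∀ i : Fin (m + 1),
    FirstOrder.Language.Structure.RelMap (symR (Θ := Θ) (S i)) ![c i.castSucc, c i.succ]

section

variable (Θ : Set ℕ)

/-- For `a₁ ∈ U`, `b ∈ V` with `a₁ A b₁` and an `S`-path `b` there is an `S`-path `a` from `a₁`
with `a_{m+2} B b_{m+2}`. -/
def Back {U V : Type*} [(corrLang Θ).Structure U] [(corrLang Θ).Structure V] {m : ℕ}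
    (S : Fin (m + 1) → ℕ) (A B : U → V → Prop) : Prop :=
  ∀ (a₁ : U) (b : Fin (m + 2) → V), A a₁ (b 0) → IsPath Θ S b →
    ∃ a : Fin (m + 2) → U, a 0 = a₁ ∧ IsPath Θ S a ∧ B (a (Fin.last _)) (b (Fin.last _))

/-- For `b₁ ∈ V`, `a ∈ U` with `a₁ A b₁` and an `S`-path `a` there is an `S`-path `b` from `b₁`
with `a_{m+2} B b_{m+2}`. -/
def Forth {U V : Type*} [(corrLang Θ).Structure U] [(corrLang Θ).Structure V] {m : ℕ}
    (S : Fin (m + 1) → ℕ) (A B : U → V → Prop) : Prop :=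
  ∀ (a : Fin (m + 2) → U) (b₁ : V), A (a 0) b₁ → IsPath Θ S a →
    ∃ b : Fin (m + 2) → V, b 0 = b₁ ∧ IsPath Θ S b ∧ B (a (Fin.last _)) (b (Fin.last _))

variable {U₁ U₂ : Type*} [(corrLang Θ).Structure U₁] [(corrLang Θ).Structure U₂]

/-- The conditions `back` (for `∀`) and `forth` (for `∃`), in both directions. -/
def StepCond {m : ℕ} (Q : Quant) (S : Fin (m + 1) → ℕ) (A B : BiRel U₁ U₂) : Prop :=
  match Q with
  | .all => Back Θ S A.fwd B.fwd ∧ Back Θ S A.bwd B.bwd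
  | .ex => Forth Θ S A.fwd B.fwd ∧ Forth Θ S A.bwd B.bwd

/-- The conditions `s-back` (for `∀`) and `s-forth` (for `∃`): `back`, resp. `forth`, both with
`B` and with the inverse of `B` at the ends of the paths. -/
def SpecialStepCond {m : ℕ} (Q : Quant) (S : Fin (m + 1) → ℕ) (A B : BiRel U₁ U₂) : Prop :=
  StepCond Θ Q S A B ∧ StepCond Θ Q S A B.inv

open Classical in
/-- The operation `[f]` on sets of relations. -/
noncomputable def boolOp {k : ℕ} {U₁ U₂ : Type*} (f : (Fin k → Bool) → Bool)
    (β : Set (BiRel U₁ U₂)) : Set (BiRel U₁ U₂) :=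
  if IsConstantFn f then Set.univ
  else if Monotone f then β
  else if Antitone f then BiRel.inv '' β
  else (fun A => A.inter A.inv) '' β

/-- The operation `[μ]`: a set of tuples `⟨A₁, …, A_{δ(μ)+1}⟩` of relations. -/
def connOp {k : ℕ} (β : Set (BiRel U₁ U₂)) :
    (μ : PreConn k) → Set (Fin (μ.degree + 1) → BiRel U₁ U₂)
  | .core b => {A | A 0 ∈ boolOp b.eval β}
  | .guard Q m S μ => {A : Fin (μ.degree + 1 + 1) → BiRel U₁ U₂ |
      ((PreConn.guard Q m S μ).IsSpecial →
        A (Fin.last μ.degree).castSucc ∈ β ∧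
          SpecialStepCond Θ Q S (A (Fin.last _)) (A (Fin.last μ.degree).castSucc)) ∧
      (¬ (PreConn.guard Q m S μ).IsSpecial →
        Fin.init A ∈ connOp β μ ∧
          StepCond Θ Q S (A (Fin.last _)) (A (Fin.last μ.degree).castSucc))}

/-- `φ(x)` is invariant with respect to `A`: its truth is carried along `A`, from `U₁` to `U₂`
and from `U₂` to `U₁`. -/
def InvariantUnder {Θ : Set ℕ} {U₁ U₂ : Type*} [(corrLang Θ).Structure U₁]
    [(corrLang Θ).Structure U₂] (φ : CorrFormula Θ) (A : BiRel U₁ U₂) : Prop :=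
  (∀ a b, A.fwd a b → TrueAt a φ → TrueAt b φ) ∧ (∀ b a, A.bwd b a → TrueAt b φ → TrueAt a φ)

/-- `A` is an asimulation between two models, for the fragment generated by `𝕄`. -/
def IsAsimulation (𝕄 : Set Conn) (A : BiRel U₁ U₂) : Prop :=
  A.IsNonempty ∧ (∀ n : Θ, InvariantUnder (atomP n) A) ∧
    ∀ μ ∈ 𝕄, ∃ t ∈ connOp Θ {A} μ.2, t (Fin.last _) = A

end

universe u

/-- Invariance with respect to all asimulations between models over `Θ`. -/
def InvariantUnderAsimulations {Θ : Set ℕ} (𝕄 : Set Conn) (φ : CorrFormula Θ) : Prop :=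
  ∀ (U₁ U₂ : Type u) [Nonempty U₁] [Nonempty U₂] [(corrLang Θ).Structure U₁]
    [(corrLang Θ).Structure U₂] (A : BiRel U₁ U₂),
    IsAsimulation Θ 𝕄 A → InvariantUnder φ A

/-!
A connective acts on the truth sets of formulas, classes of pointed models, and every formula of
the fragment is invariant by induction along this action. A core `f` that is not TFT
survives `∀` when the back condition holds for both `B` and `B⁻¹`: an end refuting `f` is squeezed
between the ends of two matching paths, at both of which `f` holds.

Conversely, let `L` be the set of truth sets of the fragment, a bounded sublattice, and suppose
that the truth set of `φ` is not in `L`. By compactness there are points `p` and `q` of saturated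
ultraproducts such that `φ` holds at `p` but not at `q`, while every member of `L` containing `p`
contains `q`. It remains to see that inclusion with respect to `L` is an asimulation. Saturation
gives the condition for a quantifier `∀` (`∃`) between the inclusion relations of `G` and `H` if
`H` is closed under finite unions (intersections) and the guarded quantifier maps `H` into `G`.
The values of a non-special core on `L` contain a set `H` with this closure property whose
inclusion relation is the one prescribed by `[μ]`. For a special core `L` itself and the set of
complements of its members have the property and lie among the values. In degree `2` the inner
guarded sets have it because the values of a non-constant weakly special core on `L` are closed
under the dual operation, over which the inner quantifier distributes.
-/

open FirstOrder

/-! ### Boolean functions -/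

section BooleanFunctions

variable {k : ℕ} {f : (Fin k → Bool) → Bool}

theorem exists_le_of_not_monotone (hf : ¬ Monotone f) :
    ∃ v w, v ≤ w ∧ f v = true ∧ f w = false := by
  simpa [Monotone, Bool.le_iff_imp] using hf

theorem exists_le_of_not_antitone (hf : ¬ Antitone f) :
    ∃ v w, v ≤ w ∧ f v = false ∧ f w = true := by
  simpa [Antitone, Bool.le_iff_imp, and_comm] using hf

theorem isConstantFn_of_monotone_of_antitone (hm : Monotone f) (ha : Antitone f) :
    IsConstantFn f := fun _ _ =>
  (le_antisymm (hm inf_le_left) (ha inf_le_left)).symm.trans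
    (le_antisymm (hm inf_le_right) (ha inf_le_right))

theorem monotone_not_iff : Monotone (fun v => !f v) ↔ Antitone f := by
  simp only [Monotone, Antitone, Bool.le_iff_imp]
  grind

theorem antitone_not_iff : Antitone (fun v => !f v) ↔ Monotone f := by
  simp [← monotone_not_iff]

theorem isConstantFn_not_iff : IsConstantFn (fun v => !f v) ↔ IsConstantFn f := by
  simp [IsConstantFn]

theorem isTFT_not_iff : IsTFT (fun v => !f v) ↔ IsFTF f := by
  simp [IsTFT, IsFTF]

theorem isFTF_not_iff : IsFTF (fun v => !f v) ↔ IsTFT f := by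
  simp [IsTFT, IsFTF]

theorem isTFT_iff_exists_le :
    IsTFT f ↔ ∃ u v w, u ≤ v ∧ v ≤ w ∧ f u = true ∧ f v = false ∧ f w = true := by
  refine ⟨fun ⟨u, v, w, huv, hvw, h⟩ => ⟨u, v, w, huv.le, hvw.le, h⟩, ?_⟩
  rintro ⟨u, v, w, huv, hvw, hu, hv, hw⟩
  refine ⟨u, v, w, huv.lt_of_ne ?_, hvw.lt_of_ne ?_, hu, hv, hw⟩ <;> rintro rfl <;> simp_all

theorem isFTF_iff_exists_le :
    IsFTF f ↔ ∃ u v w, u ≤ v ∧ v ≤ w ∧ f u = false ∧ f v = true ∧ f w = false := by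
  simp [← isTFT_not_iff, isTFT_iff_exists_le]

theorem IsRest.isTFT_of_not_isFTF (hf : IsRest f) (h : ¬ IsFTF f) : IsTFT f := by
  obtain ⟨t, u, htu, ht, hu⟩ := exists_le_of_not_monotone hf.1
  obtain ⟨v, w, hvw, hv, hw⟩ := exists_le_of_not_antitone hf.2
  simp only [isFTF_iff_exists_le, not_exists, not_and, Bool.not_eq_false] at h
  -- `f` is `true` below `t`, as a chain ending in `t ≤ u` would be `FTF` otherwise.
  have htv : f (t ⊓ v) = true := by
    by_contra hlow
    exact absurd (h _ t u inf_le_left htu (by simpa using hlow) ht) (by simp [hu])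
  exact isTFT_iff_exists_le.2 ⟨t ⊓ v, v, w, inf_le_right, hvw, htv, hv, hw⟩

theorem exists_monotone_or_not_of_not_isFTF (h : ¬ IsFTF f) :
    ∃ g₁ g₂ : (Fin k → Bool) → Bool, Monotone g₁ ∧ Monotone g₂ ∧ ∀ v, f v = (g₁ v || !g₂ v) := by
  classical
  refine ⟨fun v => decide (∀ w, v ≤ w → f w = true), fun v => !decide (∀ u ≤ v, f u = true),
    ?_, ?_, fun v => ?_⟩
  · intro v v' hv
    simpa [Bool.le_iff_imp] using fun hf w hw => hf w (hv.trans hw)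
  · intro v v' hv
    simpa [Bool.le_iff_imp] using fun u hu hf => ⟨u, hu.trans hv, hf⟩
  · simp only [isFTF_iff_exists_le, not_exists, not_and, Bool.not_eq_false] at h
    rw [Bool.eq_iff_iff]
    simp only [Bool.or_eq_true, decide_eq_true_eq, Bool.not_not]
    refine ⟨fun hv => ?_, ?_⟩
    · by_contra! hcon
      obtain ⟨⟨w, hvw, hw⟩, u, huv, hu⟩ := hcon
      exact hw (h u v w huv hvw (by simpa using hu) hv)
    · rintro (hup | hdown)
      · exact hup v le_rfl
      · exact hdown v le_rfl

end BooleanFunctions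

/-! ### Bounded sublattices and Boolean functions of their elements -/

/-- A sublattice with `⊥` and `⊤`; among truth sets, closure under `∧`, `∨`, `⊥`, `⊤`. -/
structure IsBoundedSublattice {α : Type*} [Lattice α] [BoundedOrder α] (L : Set α) : Prop
    extends IsSublattice L where
  bot_mem : ⊥ ∈ L
  top_mem : ⊤ ∈ L

namespace Quant

/-- The dual quantifier. -/
def dual : Quant → Quant
  | all => ex
  | ex => all

@[simp]
theorem dual_dual (Q : Quant) : Q.dual.dual = Q := by
  cases Q <;> rfl

theorem eq_dual_of_ne {Q Q' : Quant} (h : Q' ≠ Q) : Q' = Q.dual := by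
  cases Q <;> cases Q' <;> simp_all [dual]

section

variable {α : Type*} [Lattice α]

/-- The binary operation under which the end conditions of `Q`-guarded paths must be closed:
`⊔` for `∀`, since an end that refutes a join refutes each of its members, and `⊓` for `∃`. -/
def join : Quant → α → α → α
  | all => (· ⊔ ·)
  | ex => (· ⊓ ·)

theorem join_join_join_comm (Q : Quant) (a b c d : α) :
    Q.join (Q.join a b) (Q.join c d) = Q.join (Q.join a c) (Q.join b d) := by
  cases Q
  · exact sup_sup_sup_comm a b c d
  · exact inf_inf_inf_comm a b c d

variable [BoundedOrder α]

/-- The neutral element of `Quant.join`. -/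
def unit : Quant → α
  | all => ⊥
  | ex => ⊤

@[simp]
theorem join_unit (Q : Quant) (a : α) : Q.join a Q.unit = a := by
  cases Q <;> simp [join, unit]

@[simp]
theorem unit_join (Q : Quant) (a : α) : Q.join Q.unit a = a := by
  cases Q <;> simp [join, unit]

end

section

variable {α : Type*} [BooleanAlgebra α]

theorem compl_join (Q : Quant) (a b : α) : (Q.join a b)ᶜ = Q.dual.join aᶜ bᶜ := by
  cases Q <;> simp [join, dual]

theorem compl_unit (Q : Quant) : (Q.unit : α)ᶜ = Q.dual.unit := by
  cases Q <;> simp [unit, dual]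

end

end Quant

/-- Closure under the finite joins of `Q`, including the empty one. -/
structure JoinClosed {α : Type*} [Lattice α] [BoundedOrder α] (Q : Quant) (H : Set α) : Prop where
  unit_mem : Q.unit ∈ H
  join_mem : ∀ {a b}, a ∈ H → b ∈ H → Q.join a b ∈ H

section JoinClosed

variable {α : Type*} {Q : Quant}

theorem IsBoundedSublattice.joinClosed [Lattice α] [BoundedOrder α] {L : Set α}
    (hL : IsBoundedSublattice L) : JoinClosed Q L := by
  cases Q
  · exact ⟨hL.bot_mem, fun ha hb => hL.supClosed ha hb⟩
  · exact ⟨hL.top_mem, fun ha hb => hL.infClosed ha hb⟩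

theorem JoinClosed.image2_join [Lattice α] [BoundedOrder α] {G H : Set α}
    (hG : JoinClosed Q G) (hH : JoinClosed Q H) : JoinClosed Q (Set.image2 Q.join G H) where
  unit_mem := ⟨_, hG.unit_mem, _, hH.unit_mem, Q.join_unit _⟩
  join_mem := by
    rintro _ _ ⟨a, ha, b, hb, rfl⟩ ⟨c, hc, d, hd, rfl⟩
    exact ⟨_, hG.join_mem ha hc, _, hH.join_mem hb hd, Q.join_join_join_comm a c b d⟩

theorem JoinClosed.compl_image [BooleanAlgebra α] {H : Set α} (hH : JoinClosed Q H) :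
    JoinClosed Q.dual (compl '' H) where
  unit_mem := ⟨_, hH.unit_mem, Q.compl_unit⟩
  join_mem := by
    rintro _ _ ⟨a, ha, rfl⟩ ⟨b, hb, rfl⟩
    exact ⟨_, hH.join_mem ha hb, Q.compl_join a b⟩

theorem IsBoundedSublattice.compl_image [BooleanAlgebra α] {L : Set α}
    (hL : IsBoundedSublattice L) : IsBoundedSublattice (compl '' L) where
  supClosed := by
    rintro _ ⟨a, ha, rfl⟩ _ ⟨b, hb, rfl⟩
    exact ⟨a ⊓ b, hL.infClosed ha hb, compl_inf⟩
  infClosed := by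
    rintro _ ⟨a, ha, rfl⟩ _ ⟨b, hb, rfl⟩
    exact ⟨a ⊔ b, hL.supClosed ha hb, compl_sup⟩
  bot_mem := ⟨⊤, hL.top_mem, compl_top⟩
  top_mem := ⟨⊥, hL.bot_mem, compl_bot⟩

end JoinClosed

section BoolImage

variable {X : Type*} {k : ℕ} {f : (Fin k → Bool) → Bool}

open Classical in
/-- The truth values at `x` of the propositions `ψ i`. -/
noncomputable def truthValues (ψ : Fin k → Set X) (x : X) : Fin k → Bool :=
  fun i => decide (x ∈ ψ i)

/-- The Boolean function `f` applied to sets. -/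
def boolInterp (f : (Fin k → Bool) → Bool) (ψ : Fin k → Set X) : Set X :=
  {x | f (truthValues ψ x) = true}

/-- All values of the Boolean function `f` on members of `L`. -/
def boolImage (f : (Fin k → Bool) → Bool) (L : Set (Set X)) : Set (Set X) :=
  {s | ∃ ψ : Fin k → Set X, (∀ i, ψ i ∈ L) ∧ boolInterp f ψ = s}

@[simp]
theorem truthValues_eq_true {ψ : Fin k → Set X} {x : X} {i : Fin k} :
    truthValues ψ x i = true ↔ x ∈ ψ i := by
  simp [truthValues]

@[simp]
theorem mem_boolInterp {ψ : Fin k → Set X} {x : X} :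
    x ∈ boolInterp f ψ ↔ f (truthValues ψ x) = true :=
  Iff.rfl

theorem truthValues_le {ψ : Fin k → Set X} {x y : X} (h : ∀ i, x ∈ ψ i → y ∈ ψ i) :
    truthValues ψ x ≤ truthValues ψ y := fun i => by
  simpa [Bool.le_iff_imp] using h i

theorem boolInterp_eq_of_isConstantFn (hf : IsConstantFn f) (v : Fin k → Bool)
    (ψ : Fin k → Set X) : boolInterp f ψ = if f v then ⊤ else ⊥ := by
  ext x
  rw [mem_boolInterp, hf _ v]
  split_ifs with h <;> simp [h]

theorem boolInterp_not (ψ : Fin k → Set X) :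
    boolInterp (fun v => !f v) ψ = (boolInterp f ψ)ᶜ := by
  ext x; simp

theorem boolImage_not (L : Set (Set X)) :
    boolImage (fun v => !f v) L = compl '' boolImage f L := by
  ext s
  simp [boolImage, boolInterp_not]

theorem compl_image_boolImage_not (L : Set (Set X)) :
    compl '' boolImage (fun v => !f v) L = boolImage f L := by
  simp only [← boolImage_not, Bool.not_not]

open Classical in
theorem exists_truthValues_eq_of_chain {L : Set (Set X)} (hL : IsBoundedSublattice L)
    {u v w : Fin k → Bool} (huv : u ≤ v) (hvw : v ≤ w) {s t : Set X} (hs : s ∈ L) (ht : t ∈ L) :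
    ∃ ψ : Fin k → Set X, (∀ i, ψ i ∈ L) ∧
      ∀ x, truthValues ψ x = if x ∈ s then if x ∈ t then w else v else u := by
  refine ⟨fun i => if u i then ⊤ else if v i then s else if w i then s ⊓ t else ⊥, fun i => ?_,
    fun x => funext fun i => ?_⟩
  · dsimp only
    split_ifs
    exacts [hL.top_mem, hs, hL.infClosed hs ht, hL.bot_mem]
  · have huv := Bool.le_iff_imp.1 (huv i)
    have hvw := Bool.le_iff_imp.1 (hvw i)
    rw [Bool.eq_iff_iff, truthValues_eq_true]
    split_ifs <;> simp_all

variable {L : Set (Set X)}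

theorem subset_boolImage_of_not_antitone (hL : IsBoundedSublattice L) (hf : ¬ Antitone f) :
    L ⊆ boolImage f L := by
  intro s hs
  obtain ⟨v, w, hvw, hv, hw⟩ := exists_le_of_not_antitone hf
  obtain ⟨ψ, hψ, hvalue⟩ := exists_truthValues_eq_of_chain hL hvw le_rfl hs hs
  refine ⟨ψ, hψ, Set.ext fun x => ?_⟩
  rw [mem_boolInterp, hvalue]
  split_ifs <;> simp_all

theorem compl_image_subset_boolImage_of_not_monotone (hL : IsBoundedSublattice L)
    (hf : ¬ Monotone f) : compl '' L ⊆ boolImage f L := by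
  rw [← compl_image_boolImage_not]
  exact Set.image_mono (subset_boolImage_of_not_antitone hL (antitone_not_iff.not.2 hf))

theorem sup_compl_mem_boolImage_of_isTFT (hL : IsBoundedSublattice L) (hf : IsTFT f) {s t : Set X}
    (hs : s ∈ L) (ht : t ∈ L) : s ⊔ tᶜ ∈ boolImage f L := by
  obtain ⟨u, v, w, huv, hvw, hu, hv, hw⟩ := hf
  obtain ⟨ψ, hψ, hvalue⟩ := exists_truthValues_eq_of_chain hL huv.le hvw.le ht hs
  refine ⟨ψ, hψ, Set.ext fun x => ?_⟩
  rw [mem_boolInterp, hvalue]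
  split_ifs <;> simp_all

theorem inf_compl_mem_boolImage_of_isFTF (hL : IsBoundedSublattice L) (hf : IsFTF f) {s t : Set X}
    (hs : s ∈ L) (ht : t ∈ L) : s ⊓ tᶜ ∈ boolImage f L := by
  obtain ⟨u, v, w, huv, hvw, hu, hv, hw⟩ := hf
  obtain ⟨ψ, hψ, hvalue⟩ := exists_truthValues_eq_of_chain hL huv.le hvw.le hs ht
  refine ⟨ψ, hψ, Set.ext fun x => ?_⟩
  rw [mem_boolInterp, hvalue]
  split_ifs <;> simp_all

theorem image2_join_subset_boolImage (hL : IsBoundedSublattice L) {Q : Quant}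
    (hf : ¬ WeaklySpecialFn Q f) : Set.image2 Q.join L (compl '' L) ⊆ boolImage f L := by
  rintro _ ⟨s, hs, _, ⟨t, ht, rfl⟩, rfl⟩
  cases Q
  · exact sup_compl_mem_boolImage_of_isTFT hL (not_not.1 hf) hs ht
  · exact inf_compl_mem_boolImage_of_isFTF hL (not_not.1 hf) hs ht

theorem boolInterp_mem_of_monotone (hL : IsBoundedSublattice L) (hf : Monotone f)
    {ψ : Fin k → Set X} (hψ : ∀ i, ψ i ∈ L) : boolInterp f ψ ∈ L := by
  have disjunctive_normal_form : boolInterp f ψ =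
      {v | f v = true}.toFinset.sup fun v => {i | v i = true}.toFinset.inf ψ := by
    ext x
    simp only [mem_boolInterp, Finset.sup_set_eq_biUnion, Finset.inf_eq_iInf, Set.iInf_eq_iInter,
      Set.mem_toFinset, Set.mem_ofPred_eq, Set.mem_iUnion, Set.mem_iInter, exists_prop]
    refine ⟨fun hx => ⟨_, hx, fun i => truthValues_eq_true.1⟩, fun ⟨v, hv, hvx⟩ => ?_⟩
    refine Bool.le_iff_imp.1 (hf fun i => ?_) hv
    simpa [Bool.le_iff_imp] using hvx i
  rw [disjunctive_normal_form]
  exact Finset.sup_mem L hL.bot_mem (fun _ ha _ hb => hL.supClosed ha hb) _ _ fun v _ =>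
    Finset.inf_mem L hL.top_mem (fun _ ha _ hb => hL.infClosed ha hb) _ _ fun i _ => hψ i

theorem boolImage_eq_of_monotone (hL : IsBoundedSublattice L) (hf : Monotone f)
    (hc : ¬ IsConstantFn f) : boolImage f L = L := by
  refine Set.Subset.antisymm ?_ (subset_boolImage_of_not_antitone hL fun ha =>
    hc (isConstantFn_of_monotone_of_antitone hf ha))
  rintro _ ⟨ψ, hψ, rfl⟩
  exact boolInterp_mem_of_monotone hL hf hψ

theorem boolImage_eq_of_antitone (hL : IsBoundedSublattice L) (hf : Antitone f)
    (hc : ¬ IsConstantFn f) : boolImage f L = compl '' L := by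
  rw [← compl_image_boolImage_not, boolImage_eq_of_monotone hL (monotone_not_iff.2 hf)
    (isConstantFn_not_iff.not.2 hc)]

theorem boolImage_subset_image2_sup_of_not_isFTF (hL : IsBoundedSublattice L) (hf : ¬ IsFTF f) :
    boolImage f L ⊆ Set.image2 (· ⊔ ·) L (compl '' L) := by
  rintro _ ⟨ψ, hψ, rfl⟩
  obtain ⟨g₁, g₂, hg₁, hg₂, hfg⟩ := exists_monotone_or_not_of_not_isFTF hf
  refine ⟨_, boolInterp_mem_of_monotone hL hg₁ hψ, _, ⟨_, boolInterp_mem_of_monotone hL hg₂ hψ,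
    rfl⟩, ?_⟩
  ext x
  simp [hfg]

theorem joinClosed_all_boolImage (hL : IsBoundedSublattice L) (hf : ¬ IsFTF f)
    (hc : ¬ IsConstantFn f) : JoinClosed .all (boolImage f L) := by
  by_cases hm : Monotone f
  · rw [boolImage_eq_of_monotone hL hm hc]
    exact hL.joinClosed
  by_cases ha : Antitone f
  · rw [boolImage_eq_of_antitone hL ha hc]
    exact hL.compl_image.joinClosed
  have hTFT := IsRest.isTFT_of_not_isFTF ⟨hm, ha⟩ hf
  rw [(boolImage_subset_image2_sup_of_not_isFTF hL hf).antisymm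
    (image2_join_subset_boolImage (Q := .all) hL (not_not.2 hTFT))]
  exact hL.joinClosed.image2_join hL.compl_image.joinClosed

theorem joinClosed_boolImage (hL : IsBoundedSublattice L) {Q : Quant}
    (hf : WeaklySpecialFn Q.dual f) (hc : ¬ IsConstantFn f) : JoinClosed Q (boolImage f L) := by
  cases Q
  · exact joinClosed_all_boolImage hL hf hc
  · rw [← compl_image_boolImage_not]
    exact (joinClosed_all_boolImage hL (isFTF_not_iff.not.2 hf)
      (isConstantFn_not_iff.not.2 hc)).compl_image

end BoolImage

/-! ### Truth sets -/

/-- A `Θ`-model with a distinguished element, at which formulas `φ(x)` are evaluated. -/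
structure PointedModel (Θ : Set ℕ) where
  {Carrier : Type u}
  [str : (corrLang Θ).Structure Carrier]
  pt : Carrier

attribute [instance] PointedModel.str

/-- There is an `S`-path from `a` to `b`. -/
def Reaches (Θ : Set ℕ) {U : Type*} [(corrLang Θ).Structure U] {m : ℕ} (S : Fin (m + 1) → ℕ)
    (a b : U) : Prop :=
  ∃ c : Fin (m + 2) → U, IsPath Θ S c ∧ c 0 = a ∧ c (Fin.last _) = b

section TruthSets

variable {Θ : Set ℕ} {m k : ℕ} {S : Fin (m + 1) → ℕ}

/-- The class of all pointed models at which `φ` is true. -/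
def truthSet (φ : CorrFormula Θ) : Set (PointedModel.{u} Θ) := {p | TrueAt p.pt φ}

/-- The action of a block of quantifiers guarded by `S`-paths on truth sets. -/
def guardInterp (Q : Quant) (S : Fin (m + 1) → ℕ) (s : Set (PointedModel.{u} Θ)) :
    Set (PointedModel.{u} Θ) :=
  match Q with
  | .all => {p | ∀ b, Reaches Θ S p.pt b → .mk b ∈ s}
  | .ex => {p | ∃ b, Reaches Θ S p.pt b ∧ .mk b ∈ s}

/-- The action of a connective on truth sets. -/
def PreConn.interp : PreConn k → (Fin k → Set (PointedModel.{u} Θ)) → Set (PointedModel.{u} Θ)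
  | core b, ψ => boolInterp b.eval ψ
  | guard Q _ S μ, ψ => guardInterp Q S (μ.interp ψ)

theorem guardInterp_compl (Q : Quant) (s : Set (PointedModel.{u} Θ)) :
    guardInterp Q S sᶜ = (guardInterp Q.dual S s)ᶜ := by
  ext p
  cases Q <;> simp [guardInterp, Quant.dual]

theorem guardInterp_dual_join (Q : Quant) (s t : Set (PointedModel.{u} Θ)) :
    guardInterp Q.dual S (Q.join s t) =
      Q.join (guardInterp Q.dual S s) (guardInterp Q.dual S t) := by
  ext p
  cases Q
  · simp [guardInterp, Quant.dual, Quant.join, and_or_left, exists_or]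
  · simp [guardInterp, Quant.dual, Quant.join, forall_and]

theorem guardInterp_dual_unit (Q : Quant) :
    guardInterp Q.dual S (Q.unit : Set (PointedModel.{u} Θ)) = Q.unit := by
  ext p
  cases Q <;> simp [guardInterp, Quant.dual, Quant.unit]

theorem JoinClosed.guardInterp_image {Q : Quant} {H : Set (Set (PointedModel.{u} Θ))}
    (hH : JoinClosed Q H) : JoinClosed Q (guardInterp Q.dual S '' H) where
  unit_mem := ⟨_, hH.unit_mem, guardInterp_dual_unit Q⟩
  join_mem := by
    rintro _ _ ⟨s, hs, rfl⟩ ⟨t, ht, rfl⟩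
    exact ⟨_, hH.join_mem hs ht, guardInterp_dual_join Q s t⟩

theorem truthSet_not (φ : CorrFormula Θ) : truthSet φ.not = (truthSet.{u} φ)ᶜ := by
  ext p
  exact Language.Formula.realize_not

theorem truthSet_inf (φ ψ : CorrFormula Θ) : truthSet (φ ⊓ ψ) = truthSet.{u} φ ⊓ truthSet ψ := by
  ext p
  exact Language.Formula.realize_inf

theorem truthSet_sup (φ ψ : CorrFormula Θ) : truthSet (φ ⊔ ψ) = truthSet.{u} φ ⊔ truthSet ψ := by
  ext p
  exact Language.Formula.realize_sup

theorem truthSet_boolComb (b : BoolComb k) (ψ : Fin k → CorrFormula Θ) :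
    truthSet (b.apply ψ) = boolInterp b.eval fun i => truthSet.{u} (ψ i) := by
  induction b with
  | atom i => ext p; simp [BoolComb.apply, BoolComb.eval]
  | top => ext p; simp [BoolComb.apply, BoolComb.eval, truthSet, TrueAt]
  | bot => ext p; simp [BoolComb.apply, BoolComb.eval, truthSet, TrueAt]
  | neg b ih => ext p; simp [BoolComb.apply, BoolComb.eval, truthSet_not, ih]
  | and b c ihb ihc => ext p; simp [BoolComb.apply, BoolComb.eval, truthSet_inf, ihb, ihc]
  | or b c ihb ihc => ext p; simp [BoolComb.apply, BoolComb.eval, truthSet_sup, ihb, ihc]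

section Realize

variable {U : Type*} [(corrLang Θ).Structure U]

theorem realize_pathVar (a : U) (xs : Fin m → U) (i : Fin (m + 1)) :
    (pathVar (Θ := Θ) m i).realize (Sum.elim (fun _ => a) xs) =
      (Fin.cons a xs : Fin (m + 1) → U) i := by
  induction i using Fin.cases <;> simp [pathVar]

theorem realize_pathFormula (S : Fin (m + 1) → ℕ) (a : U) (xs : Fin (m + 1) → U) :
    (pathFormula (Θ := Θ) S).Realize (fun _ => a) xs ↔
      IsPath Θ S (Fin.cons a xs : Fin (m + 2) → U) := by
  simp [pathFormula, IsPath, Language.BoundedFormula.realize_iInf,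
    Language.BoundedFormula.realize_rel₂, realize_pathVar]

theorem realize_atLast (ψ : CorrFormula Θ) (a : U) (xs : Fin (m + 1) → U) :
    (atLast m ψ).Realize (fun _ => a) xs ↔ TrueAt (xs (Fin.last m)) ψ := by
  unfold atLast TrueAt Language.Formula.Realize
  erw [Language.BoundedFormula.realize_relabel]
  rw [iff_eq_eq]
  exact congr rfl (Subsingleton.elim _ _)

theorem reaches_iff_exists_tail {a b : U} :
    Reaches Θ S a b ↔ ∃ xs : Fin (m + 1) → U,
      IsPath Θ S (Fin.cons a xs : Fin (m + 2) → U) ∧ xs (Fin.last m) = b := by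
  refine ⟨?_, fun ⟨xs, hxs, hb⟩ => ⟨_, hxs, rfl, hb⟩⟩
  rintro ⟨c, hc, rfl, hb⟩
  exact ⟨Fin.tail c, by rwa [Fin.cons_self_tail], hb⟩

end Realize

theorem truthSet_guardFormula (Q : Quant) (S : Fin (m + 1) → ℕ) (ψ : CorrFormula Θ) :
    truthSet (guardFormula Q S ψ) = guardInterp Q S (truthSet.{u} ψ) := by
  ext p
  cases Q
  · simp [truthSet, guardInterp, guardFormula, TrueAt, reaches_iff_exists_tail,
      realize_pathFormula, realize_atLast]
  · simp [truthSet, guardInterp, guardFormula, TrueAt, reaches_iff_exists_tail,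
      realize_pathFormula, realize_atLast]

theorem truthSet_apply (μ : PreConn k) (ψ : Fin k → CorrFormula Θ) :
    truthSet (μ.apply ψ) = μ.interp fun i => truthSet.{u} (ψ i) := by
  induction μ with
  | core b => exact truthSet_boolComb b ψ
  | guard Q m S μ ih => rw [PreConn.interp, ← ih]; exact truthSet_guardFormula Q S _

/-- `⇔[∅]` speaks of models in `Type`, truth sets of models in `Type u`. -/
theorem truthSet_eq_iff {φ ψ : CorrFormula Θ} : truthSet.{u} φ = truthSet ψ ↔ φ ⇔[∅] ψ := by
  refine ⟨fun h => Language.Theory.models_formula_iff.2 fun M v => ?_, fun h => Set.ext fun p => ?_⟩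
  · let : (corrLang Θ).Structure (ULift.{u} M) := Equiv.inducedStructure Equiv.ulift.symm
    let e : M ≃[corrLang Θ] ULift.{u} M := Equiv.inducedStructureEquiv Equiv.ulift.symm
    have truth_e : ∀ χ : CorrFormula Θ, .mk (e (v ())) ∈ truthSet.{u} χ ↔ χ.Realize v := fun χ =>
      Language.StrongHomClass.realize_formula e χ
    rw [Language.Formula.realize_iff, ← truth_e, ← truth_e, h]
  · have : Nonempty p.Carrier := ⟨p.pt⟩
    exact h.realize_iff

end TruthSets

section Equivalence

variable {Θ : Set ℕ} {k : ℕ}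

/-- The model of the full vocabulary in which the letters `P i`, `i < k`, are interpreted by the
sets `ψ i`: at it the formula `μ` is evaluated to find `μ.interp ψ`. -/
def PointedModel.expand (ψ : Fin k → Set (PointedModel.{u} Θ)) (p : PointedModel.{u} Θ) :
    PointedModel.{u} Set.univ :=
  letI : (corrLang Set.univ).Structure p.Carrier :=
    { funMap := fun f => f.elim
      RelMap := fun {_} r => match r with
        | .P n => fun x => ∃ i : Fin k, (i : ℕ) = n ∧ .mk (x 0) ∈ ψ i
        | .R i => fun x => Language.Structure.RelMap (symR (Θ := Θ) i) x }
  .mk p.pt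

namespace PreConn

theorem expand_preimage_truthSet_atomP (ψ : Fin k → Set (PointedModel.{u} Θ)) (i : Fin k) :
    PointedModel.expand ψ ⁻¹' truthSet (atomP ⟨i, Set.mem_univ _⟩) = ψ i := by
  ext p
  refine Language.Formula.realize_rel₁.trans ⟨fun ⟨j, hj, h⟩ => ?_, fun h => ⟨i, rfl, h⟩⟩
  obtain rfl := Fin.ext hj
  exact h

theorem expand_preimage_interp (ψ : Fin k → Set (PointedModel.{u} Θ)) {l : ℕ} (μ : PreConn l)
    (χ : Fin l → Set (PointedModel.{u} Set.univ)) :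
    PointedModel.expand ψ ⁻¹' μ.interp χ = μ.interp fun i => PointedModel.expand ψ ⁻¹' χ i := by
  induction μ with
  | core b => rfl
  | guard Q m S μ ih =>
    rw [interp, interp, ← ih]
    cases Q <;> rfl

theorem expand_preimage_truthSet_toFormula (μ : PreConn k)
    (ψ : Fin k → Set (PointedModel.{u} Θ)) :
    PointedModel.expand ψ ⁻¹' truthSet μ.toFormula = μ.interp ψ := by
  simp only [toFormula, truthSet_apply, expand_preimage_interp, expand_preimage_truthSet_atomP]

theorem Equivalent.interp_eq {μ ν : PreConn k} (h : μ.Equivalent ν)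
    (ψ : Fin k → Set (PointedModel.{u} Θ)) : μ.interp ψ = ν.interp ψ := by
  rw [← expand_preimage_truthSet_toFormula, ← expand_preimage_truthSet_toFormula,
    truthSet_eq_iff.2 h]

theorem equivalent_of_interp_eq {μ ν : PreConn k}
    (h : ∀ ψ : Fin k → Set (PointedModel.{0} Set.univ), μ.interp ψ = ν.interp ψ) :
    μ.Equivalent ν :=
  truthSet_eq_iff.{0}.1 <| by simp only [toFormula, truthSet_apply, h]

/-- Otherwise `Q` would commute with the constant, and the connective have degree `0`. -/
theorem IsGuardedConnective.unit_mem_boolImage {Q : Quant} {m : ℕ} {S : Fin (m + 1) → ℕ}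
    {b : BoolComb k} (h : (guard Q m S (core b)).IsGuardedConnective) (hc : IsConstantFn b.eval)
    {X : Type*} {L : Set (Set X)} (hL : L.Nonempty) : Q.unit ∈ boolImage b.eval L := by
  obtain ⟨s, hs⟩ := hL
  refine ⟨fun _ => s, fun _ => hs, ?_⟩
  by_contra hunit
  have interp_core : ∀ ψ : Fin k → Set (PointedModel.{0} Set.univ),
      boolInterp b.eval ψ = Q.dual.unit := by
    intro ψ
    rw [boolInterp_eq_of_isConstantFn hc fun _ => true] at hunit ⊢
    split_ifs at hunit ⊢ <;> cases Q <;> simp_all [Quant.unit, Quant.dual]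
  rw [IsGuardedConnective] at h
  refine h.2.2 ⟨core b, Nat.zero_lt_one, by rw [IsGuardedConnective]; trivial,
    equivalent_of_interp_eq fun ψ => ?_⟩
  have guard_unit := guardInterp_dual_unit.{0} (Θ := Set.univ) (S := S) Q.dual
  rw [Quant.dual_dual] at guard_unit
  change guardInterp Q S (boolInterp b.eval ψ) = boolInterp b.eval ψ
  rw [interp_core, guard_unit]

end PreConn

end Equivalence

/-! ### Invariance -/

section Invariance

variable {Θ : Set ℕ} {U V : Type u} [(corrLang Θ).Structure U] [(corrLang Θ).Structure V]
  {m k : ℕ} {S : Fin (m + 1) → ℕ}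

theorem back_iff_reaches {A B : U → V → Prop} :
    Back Θ S A B ↔ ∀ a b, A a b → ∀ b', Reaches Θ S b b' → ∃ a', Reaches Θ S a a' ∧ B a' b' := by
  refine ⟨?_, fun h a c hac hc => ?_⟩
  · rintro h a _ hab _ ⟨c, hc, rfl, rfl⟩
    obtain ⟨d, rfl, hd, hB⟩ := h a c hab hc
    exact ⟨_, ⟨d, hd, rfl, rfl⟩, hB⟩
  · obtain ⟨_, ⟨d, hd, rfl, rfl⟩, hB⟩ := h a _ hac _ ⟨c, hc, rfl, rfl⟩
    exact ⟨d, rfl, hd, hB⟩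

theorem forth_iff_back_flip {A B : U → V → Prop} :
    Forth Θ S A B ↔ Back Θ S (flip A) (flip B) :=
  forall_comm

/-- Membership in `s` is carried along `A`. -/
def Preserves (A : U → V → Prop) (s : Set (PointedModel.{u} Θ)) : Prop :=
  ∀ a b, A a b → .mk a ∈ s → .mk b ∈ s

theorem preserves_flip_compl {A : U → V → Prop} {s : Set (PointedModel.{u} Θ)} :
    Preserves (flip A) sᶜ ↔ Preserves A s :=
  forall_comm.trans <| forall₃_congr fun _ _ _ => not_imp_not

theorem Back.preserves_guardInterp_boolInterp {A B B' : U → V → Prop} (h : Back Θ S A B)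
    (h' : Back Θ S A B') {f : (Fin k → Bool) → Bool} (hf : ¬ IsTFT f)
    {ψ : Fin k → Set (PointedModel.{u} Θ)}
    (hψ : ∀ i, Preserves B (ψ i)) (hψ' : ∀ i, Preserves (flip B') (ψ i)) :
    Preserves A (guardInterp .all S (boolInterp f ψ)) := by
  intro a b hab ha b' hb
  obtain ⟨c, hc, hcb⟩ := back_iff_reaches.1 h a b hab b' hb
  obtain ⟨d, hd, hdb⟩ := back_iff_reaches.1 h' a b hab b' hb
  by_contra hfb
  exact hf <| isTFT_iff_exists_le.2 ⟨_, _, _, truthValues_le fun i => hψ i c b' hcb,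
    truthValues_le fun i => hψ' i b' d hdb, ha c hc, by simpa using hfb, ha d hd⟩

theorem Forth.preserves_guardInterp_boolInterp {A B B' : U → V → Prop} (h : Forth Θ S A B)
    (h' : Forth Θ S A B') {f : (Fin k → Bool) → Bool} (hf : ¬ IsFTF f)
    {ψ : Fin k → Set (PointedModel.{u} Θ)}
    (hψ : ∀ i, Preserves B (ψ i)) (hψ' : ∀ i, Preserves (flip B') (ψ i)) :
    Preserves A (guardInterp .ex S (boolInterp f ψ)) := by
  rw [← preserves_flip_compl, show Quant.ex = Quant.all.dual from rfl, ← guardInterp_compl,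
    ← boolInterp_not]
  exact (forth_iff_back_flip.1 h').preserves_guardInterp_boolInterp (forth_iff_back_flip.1 h)
    (isTFT_not_iff.not.2 hf) hψ' hψ

theorem Back.preserves {A B : U → V → Prop} (h : Back Θ S A B) {s : Set (PointedModel.{u} Θ)}
    (hs : Preserves B s) : Preserves A (guardInterp .all S s) := by
  intro a b hab ha b' hb
  obtain ⟨a', ha', hB⟩ := back_iff_reaches.1 h a b hab b' hb
  exact hs a' b' hB (ha a' ha')

theorem Forth.preserves {A B : U → V → Prop} (h : Forth Θ S A B) {s : Set (PointedModel.{u} Θ)}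
    (hs : Preserves B s) : Preserves A (guardInterp .ex S s) := by
  rw [← preserves_flip_compl, show Quant.ex = Quant.all.dual from rfl, ← guardInterp_compl]
  exact (forth_iff_back_flip.1 h).preserves (preserves_flip_compl.2 hs)

/-- Membership in `s` is carried along `A`, in both directions between the models. -/
def BiRel.Preserves (A : BiRel U V) (s : Set (PointedModel.{u} Θ)) : Prop :=
  _root_.Preserves A.fwd s ∧ _root_.Preserves A.bwd s

theorem StepCond.preserves {Q : Quant} {A B : BiRel U V} (h : StepCond Θ Q S A B)
    {s : Set (PointedModel.{u} Θ)} (hs : B.Preserves s) : A.Preserves (guardInterp Q S s) := by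
  cases Q
  · exact ⟨h.1.preserves hs.1, h.2.preserves hs.2⟩
  · exact ⟨h.1.preserves hs.1, h.2.preserves hs.2⟩

theorem SpecialStepCond.preserves {Q : Quant} {A B : BiRel U V} (h : SpecialStepCond Θ Q S A B)
    {f : (Fin k → Bool) → Bool} (hf : WeaklySpecialFn Q f) {ψ : Fin k → Set (PointedModel.{u} Θ)}
    (hψ : ∀ i, B.Preserves (ψ i)) : A.Preserves (guardInterp Q S (boolInterp f ψ)) := by
  have fwd := fun i => (hψ i).1
  have bwd := fun i => (hψ i).2
  obtain ⟨h, h'⟩ := h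
  cases Q
  · exact ⟨h.1.preserves_guardInterp_boolInterp h'.1 hf fwd bwd,
      h.2.preserves_guardInterp_boolInterp h'.2 hf bwd fwd⟩
  · exact ⟨h.1.preserves_guardInterp_boolInterp h'.1 hf fwd bwd,
      h.2.preserves_guardInterp_boolInterp h'.2 hf bwd fwd⟩

theorem preserves_boolInterp_of_mem_boolOp {A B : BiRel U V} {f : (Fin k → Bool) → Bool}
    (hB : B ∈ boolOp f {A}) {ψ : Fin k → Set (PointedModel.{u} Θ)} (hψ : ∀ i, A.Preserves (ψ i)) :
    B.Preserves (boolInterp f ψ) := by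
  have fwd_le : ∀ {a b}, A.fwd a b → truthValues ψ (.mk a) ≤ truthValues ψ (.mk b) :=
    fun h => truthValues_le fun i => (hψ i).1 _ _ h
  have bwd_le : ∀ {b a}, A.bwd b a → truthValues ψ (.mk b) ≤ truthValues ψ (.mk a) :=
    fun h => truthValues_le fun i => (hψ i).2 _ _ h
  unfold boolOp at hB
  split_ifs at hB with hc hm ha
  · exact ⟨fun _ _ _ => (hc _ _).trans, fun _ _ _ => (hc _ _).trans⟩
  · obtain rfl := hB
    exact ⟨fun _ _ h => Bool.le_iff_imp.1 (hm (fwd_le h)),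
      fun _ _ h => Bool.le_iff_imp.1 (hm (bwd_le h))⟩
  · obtain ⟨_, rfl, rfl⟩ := hB
    exact ⟨fun _ _ h => Bool.le_iff_imp.1 (ha (bwd_le h)),
      fun _ _ h => Bool.le_iff_imp.1 (ha (fwd_le h))⟩
  · obtain ⟨_, rfl, rfl⟩ := hB
    exact ⟨fun _ _ h => (congrArg f ((bwd_le h.2).antisymm (fwd_le h.1))).trans,
      fun _ _ h => (congrArg f ((fwd_le h.2).antisymm (bwd_le h.1))).trans⟩

theorem preserves_interp_of_mem_connOp {A : BiRel U V} {μ : PreConn k}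
    {ψ : Fin k → Set (PointedModel.{u} Θ)} (hψ : ∀ i, A.Preserves (ψ i))
    {t : Fin (μ.degree + 1) → BiRel U V} (ht : t ∈ connOp Θ {A} μ) :
    (t (Fin.last _)).Preserves (μ.interp ψ) := by
  induction μ with
  | core b => exact preserves_boolInterp_of_mem_boolOp ht hψ
  | guard Q m S μ ih =>
    obtain ⟨special, step⟩ := ht
    by_cases hμ : (PreConn.guard Q m S μ).IsSpecial
    · obtain ⟨hB, hstep⟩ := special hμ
      cases μ with
      | core b =>
        rw [Set.mem_singleton_iff.1 hB] at hstep
        exact hstep.preserves hμ.2 hψ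
      | guard => exact hμ.elim
    · obtain ⟨hinit, hstep⟩ := step hμ
      exact hstep.preserves (ih hinit)

theorem Fragment.preserves {𝕄 : Set Conn} {φ : CorrFormula Θ} (hφ : Fragment Θ 𝕄 φ)
    {A : BiRel U V} (hA : IsAsimulation Θ 𝕄 A) : A.Preserves (truthSet φ) := by
  induction hφ with
  | atom n => exact hA.2.1 n
  | app μ hμ ψ _ ih =>
    obtain ⟨t, ht, hlast⟩ := hA.2.2 μ hμ
    rw [truthSet_apply, ← hlast]
    exact preserves_interp_of_mem_connOp ih ht

end Invariance

/-! ### Saturated ultraproducts -/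

theorem exists_antitone_seq_of_directedOn {α : Type*} [Preorder α] {s : Set α}
    (hs : DirectedOn (· ≥ ·) s) (hc : s.Countable) (hne : s.Nonempty) :
    ∃ u : ℕ → α, Antitone u ∧ (∀ n, u n ∈ s) ∧ ∀ a ∈ s, ∃ n, u n ≤ a := by
  have := hc.toEncodable
  have : Inhabited s := ⟨⟨hne.choose, hne.choose_spec⟩⟩
  have hdir : Directed (· ≥ ·) (Subtype.val : s → α) := hs.directed_val
  exact ⟨fun n => hdir.sequence _ n, hdir.sequence_anti, fun n => (hdir.sequence _ n).2,
    fun a ha => ⟨_, hdir.sequence_le ⟨a, ha⟩⟩⟩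

theorem exists_forall_eventually_mem_of_antitone {α : ℕ → Type*} [∀ n, Nonempty (α n)]
    {l : Filter ℕ} (hl : l ≤ Filter.atTop) {s : ∀ n, ℕ → Set (α n)} (hs : ∀ n, Antitone (s n))
    (h : ∀ k, ∀ᶠ n in l, (s n k).Nonempty) :
    ∃ x : ∀ n, α n, ∀ k, ∀ᶠ n in l, x n ∈ s n k := by
  classical
  let K : ℕ → ℕ := fun n => Nat.findGreatest (fun k => (s n k).Nonempty) n
  have exists_mem : ∀ n, ∃ x, (s n (K n)).Nonempty → x ∈ s n (K n) := fun n =>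
    (em (s n (K n)).Nonempty).elim (fun ⟨x, hx⟩ => ⟨x, fun _ => hx⟩)
      fun hn => ⟨Classical.arbitrary _, fun h => (hn h).elim⟩
  choose x hx using exists_mem
  refine ⟨x, fun k => ?_⟩
  filter_upwards [h k, hl (Filter.eventually_ge_atTop k)] with n hn hkn
  exact hs n (Nat.le_findGreatest hkn hn)
    (hx n (Nat.findGreatest_spec (P := fun k => (s n k).Nonempty) hkn hn))

instance countable_corrFormula {Θ : Set ℕ} : Countable (CorrFormula Θ) := by
  have hR : Countable (Σ n, (corrLang Θ).Relations n) := by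
    refine Function.Surjective.countable (α := Θ ⊕ ℕ)
      (f := Sum.elim (fun n => ⟨1, symP n⟩) fun i => ⟨2, symR i⟩) ?_
    rintro ⟨_, n | i⟩
    · exact ⟨.inl n, rfl⟩
    · exact ⟨.inr i, rfl⟩
  have hF : Countable (Σ n, (corrLang Θ).Functions n) :=
    have : IsEmpty (Σ n, (corrLang Θ).Functions n) := ⟨fun f => f.2.elim⟩
    inferInstance
  infer_instance

/-- Along `S`-paths from `a`, a downward directed set of truth sets is met by a single endpoint as
soon as each of its members is met. -/
def PathSaturated (Θ : Set ℕ) (U : Type u) [(corrLang Θ).Structure U] : Prop :=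
  ∀ {m : ℕ} (S : Fin (m + 1) → ℕ) (a : U) (𝓢 : Set (Set (PointedModel.{u} Θ))),
    𝓢 ⊆ Set.range truthSet → 𝓢.Nonempty → DirectedOn (· ≥ ·) 𝓢 →
    (∀ s ∈ 𝓢, ∃ b, Reaches Θ S a b ∧ .mk b ∈ s) → ∃ b, Reaches Θ S a b ∧ ∀ s ∈ 𝓢, .mk b ∈ s

section Ultraproduct

variable {Θ : Set ℕ} {M : ℕ → Type u}

/-- The ultraproduct of a sequence of models along a fixed non-principal ultrafilter. -/
abbrev SeqProduct (M : ℕ → Type u) : Type u :=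
  ((Filter.hyperfilter ℕ : Ultrafilter ℕ) : Filter ℕ).Product M

/-- The element of the ultraproduct given by a sequence. -/
noncomputable def SeqProduct.mk (x : ∀ n, M n) : SeqProduct M := Quotient.mk'' x

variable [∀ n, (corrLang Θ).Structure (M n)] [∀ n, Nonempty (M n)]

theorem seqProduct_mk_mem_truthSet {x : ∀ n, M n} {φ : CorrFormula Θ} :
    .mk (SeqProduct.mk x) ∈ truthSet φ ↔
      ∀ᶠ n in Filter.hyperfilter ℕ, .mk (x n) ∈ truthSet φ :=
  Language.Ultraproduct.realize_formula_cast φ fun _ => x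

theorem relMap_seqProduct_mk {x y : ∀ n, M n} {i : ℕ} :
    Language.Structure.RelMap (symR (Θ := Θ) i) ![SeqProduct.mk x, SeqProduct.mk y] ↔
      ∀ᶠ n in Filter.hyperfilter ℕ,
        Language.Structure.RelMap (symR (Θ := Θ) i) ![x n, y n] := by
  have := Language.Ultraproduct.realize_formula_cast (u := Filter.hyperfilter ℕ) (M := M)
    (Language.Relations.formula₂ (symR (Θ := Θ) i) (.var (0 : Fin 2)) (.var (1 : Fin 2))) ![x, y]
  simpa only [Language.Formula.realize_rel₂] using! this

theorem isPath_seqProduct_mk {m : ℕ} {S : Fin (m + 1) → ℕ} {c : Fin (m + 2) → ∀ n, M n} :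
    IsPath Θ S (fun j => SeqProduct.mk (c j)) ↔
      ∀ᶠ n in Filter.hyperfilter ℕ, IsPath Θ S fun j => c j n := by
  simp only [IsPath, relMap_seqProduct_mk, Filter.eventually_all]

theorem reaches_seqProduct_mk {m : ℕ} {S : Fin (m + 1) → ℕ} {x y : ∀ n, M n} :
    Reaches Θ S (SeqProduct.mk x) (SeqProduct.mk y) ↔
      ∀ᶠ n in Filter.hyperfilter ℕ, Reaches Θ S (x n) (y n) := by
  constructor
  · rintro ⟨c, hc, hx, hy⟩
    choose d hd using fun j => Quotient.exists_rep (c j)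
    obtain rfl : (fun j => SeqProduct.mk (d j)) = c := funext hd
    filter_upwards [isPath_seqProduct_mk.1 hc, Quotient.exact hx, Quotient.exact hy]
      with n hn hxn hyn
    exact ⟨_, hn, hxn, hyn⟩
  · intro h
    choose! c hc using fun n (hn : Reaches Θ S (x n) (y n)) => hn
    exact ⟨fun j => SeqProduct.mk fun n => c n j,
      isPath_seqProduct_mk.2 (h.mono fun n hn => (hc n hn).1),
      Quotient.sound (h.mono fun n hn => (hc n hn).2.1),
      Quotient.sound (h.mono fun n hn => (hc n hn).2.2)⟩

theorem pathSaturated_seqProduct : PathSaturated Θ (SeqProduct M) := by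
  intro m S a 𝓢 hdef hne hdir hmeet
  obtain ⟨x, rfl⟩ := Quotient.exists_rep a
  obtain ⟨u, hu, hu𝓢, hcofinal⟩ :=
    exists_antitone_seq_of_directedOn hdir ((Set.countable_range _).mono hdef) hne
  have eventually_nonempty : ∀ k, ∀ᶠ n in Filter.hyperfilter ℕ,
      {y | Reaches Θ S (x n) y ∧ .mk y ∈ u k}.Nonempty := by
    intro k
    obtain ⟨b, hab, hb⟩ := hmeet _ (hu𝓢 k)
    obtain ⟨y, rfl⟩ := Quotient.exists_rep b
    obtain ⟨φ, hφ⟩ := hdef (hu𝓢 k)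
    rw [← hφ] at hb ⊢
    filter_upwards [reaches_seqProduct_mk.1 hab, seqProduct_mk_mem_truthSet.1 hb] with n hn hφn
    exact ⟨y n, hn, hφn⟩
  have antitone_ends : ∀ n, Antitone fun k => {y | Reaches Θ S (x n) y ∧ .mk y ∈ u k} :=
    fun n _ _ hkl _ => And.imp_right (hu hkl ·)
  obtain ⟨y, hy⟩ := exists_forall_eventually_mem_of_antitone Nat.hyperfilter_le_atTop
    antitone_ends eventually_nonempty
  refine ⟨SeqProduct.mk y, reaches_seqProduct_mk.2 ((hy 0).mono fun n h => h.1), fun s hs => ?_⟩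
  obtain ⟨k, hk⟩ := hcofinal s hs
  obtain ⟨φ, rfl⟩ := hdef hs
  exact seqProduct_mk_mem_truthSet.2 ((hy k).mono fun n h => hk h.2)

theorem exists_pathSaturated_forall_mem {𝓢 : Set (Set (PointedModel.{u} Θ))}
    (hdef : 𝓢 ⊆ Set.range truthSet) (hne : 𝓢.Nonempty) (hdir : DirectedOn (· ≥ ·) 𝓢)
    (h : ∀ s ∈ 𝓢, s.Nonempty) :
    ∃ p : PointedModel.{u} Θ, PathSaturated Θ p.Carrier ∧ ∀ s ∈ 𝓢, p ∈ s := by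
  obtain ⟨u, hu, hu𝓢, hcofinal⟩ :=
    exists_antitone_seq_of_directedOn hdir ((Set.countable_range _).mono hdef) hne
  choose p hp using fun n => h _ (hu𝓢 n)
  have : ∀ n, Nonempty (p n).Carrier := fun n => ⟨(p n).pt⟩
  refine ⟨.mk (SeqProduct.mk fun n => (p n).pt), pathSaturated_seqProduct, fun s hs => ?_⟩
  obtain ⟨k, hk⟩ := hcofinal s hs
  obtain ⟨φ, rfl⟩ := hdef hs
  refine seqProduct_mk_mem_truthSet.2 ?_
  filter_upwards [Nat.hyperfilter_le_atTop (Filter.eventually_ge_atTop k)] with n hn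
  exact hk (hu hn (hp n))

end Ultraproduct

/-! ### Relations of inclusion -/

section MemLE

variable {X : Type*} {p q : X}

/-- Every member of `H` that contains `p` contains `q`. -/
def MemLE (H : Set (Set X)) (p q : X) : Prop := ∀ s ∈ H, p ∈ s → q ∈ s

theorem memLE_compl_image {H : Set (Set X)} : MemLE (compl '' H) p q ↔ MemLE H q p :=
  Set.forall_mem_image.trans <| forall₂_congr fun _ _ => not_imp_not

theorem memLE_image2_join {Q : Quant} {G H : Set (Set X)} (hG : Q.unit ∈ G) (hH : Q.unit ∈ H) :
    MemLE (Set.image2 Q.join G H) p q ↔ MemLE G p q ∧ MemLE H p q := by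
  refine ⟨fun h => ⟨fun s hs => ?_, fun s hs => ?_⟩, fun ⟨hpG, hpH⟩ => ?_⟩
  · exact h s ⟨s, hs, _, hH, Q.join_unit s⟩
  · exact h s ⟨_, hG, s, hs, Q.unit_join s⟩
  · rintro _ ⟨s, hs, t, ht, rfl⟩
    cases Q
    · exact Or.imp (hpG s hs) (hpH t ht)
    · exact And.imp (hpG s hs) (hpH t ht)

theorem JoinClosed.sep_notMem {H : Set (Set X)} (hH : JoinClosed .all H) (p : X) :
    JoinClosed .all {s ∈ H | p ∉ s} where
  unit_mem := ⟨hH.unit_mem, id⟩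
  join_mem hs ht := ⟨hH.join_mem hs.1 ht.1, fun h => h.elim hs.2 ht.2⟩

end MemLE

section InclusionRel

variable {Θ : Set ℕ} {m : ℕ} {S : Fin (m + 1) → ℕ} {U V U₁ U₂ : Type u}
  [(corrLang Θ).Structure U] [(corrLang Θ).Structure V] [(corrLang Θ).Structure U₁]
  [(corrLang Θ).Structure U₂] {G H : Set (Set (PointedModel.{u} Θ))}

/-- The relation between the elements of two models that `MemLE H` defines. -/
def inclusionRel (U₁ U₂ : Type u) [(corrLang Θ).Structure U₁] [(corrLang Θ).Structure U₂]
    (H : Set (Set (PointedModel.{u} Θ))) : BiRel U₁ U₂ :=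
  ⟨fun a b => MemLE H (.mk a) (.mk b), fun b a => MemLE H (.mk b) (.mk a)⟩

theorem inclusionRel_compl_image :
    inclusionRel U₁ U₂ (compl '' H) = (inclusionRel U₁ U₂ H).inv :=
  BiRel.ext (funext₂ fun _ _ => propext memLE_compl_image)
    (funext₂ fun _ _ => propext memLE_compl_image)

theorem inclusionRel_image2_join {Q : Quant} (hG : Q.unit ∈ G) (hH : Q.unit ∈ H) :
    inclusionRel U₁ U₂ (Set.image2 Q.join G H) =
      (inclusionRel U₁ U₂ G).inter (inclusionRel U₁ U₂ H) :=
  BiRel.ext (funext₂ fun _ _ => propext (memLE_image2_join hG hH))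
    (funext₂ fun _ _ => propext (memLE_image2_join hG hH))

theorem compl_image_subset_range_truthSet (hH : H ⊆ Set.range truthSet) :
    compl '' H ⊆ Set.range truthSet := by
  rintro _ ⟨s, hs, rfl⟩
  obtain ⟨φ, rfl⟩ := hH hs
  exact ⟨_, truthSet_not φ⟩

theorem back_memLE (hU : PathSaturated Θ U) (hdef : H ⊆ Set.range truthSet)
    (hH : JoinClosed .all H) (hG : ∀ s ∈ H, guardInterp .all S s ∈ G) :
    Back Θ S (fun (a : U) (b : V) => MemLE G (.mk a) (.mk b))
      fun a b => MemLE H (.mk a) (.mk b) := by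
  rw [back_iff_reaches]
  intro a b hab b' hb'
  have refuted := (hH.sep_notMem (.mk b')).compl_image
  obtain ⟨a', ha', hrefutes⟩ := hU S a _
    (compl_image_subset_range_truthSet ((Set.sep_subset _ _).trans hdef))
    ⟨_, refuted.unit_mem⟩
    (fun s hs t ht => ⟨_, refuted.join_mem hs ht, Set.inter_subset_left, Set.inter_subset_right⟩)
    <| by
      rintro _ ⟨s, ⟨hs, hbs⟩, rfl⟩
      by_contra! hall
      exact hbs (hab _ (hG s hs) (fun c hc => not_not.1 (hall c hc)) b' hb')
  refine ⟨a', ha', fun s hs has => ?_⟩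
  by_contra hbs
  exact hrefutes _ ⟨s, ⟨hs, hbs⟩, rfl⟩ has

theorem forth_memLE (hV : PathSaturated Θ V) (hdef : H ⊆ Set.range truthSet)
    (hH : JoinClosed .ex H) (hG : ∀ s ∈ H, guardInterp .ex S s ∈ G) :
    Forth Θ S (fun (a : U) (b : V) => MemLE G (.mk a) (.mk b))
      fun a b => MemLE H (.mk a) (.mk b) := by
  have back := back_memLE (U := V) (V := U) (S := S) (G := compl '' G) hV
    (compl_image_subset_range_truthSet hdef) hH.compl_image <| by
      rintro _ ⟨s, hs, rfl⟩
      exact ⟨_, hG s hs, (guardInterp_compl .all s).symm⟩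
  simp only [memLE_compl_image] at back
  exact forth_iff_back_flip.2 back

theorem stepCond_inclusionRel (h₁ : PathSaturated Θ U₁) (h₂ : PathSaturated Θ U₂) {Q : Quant}
    (hdef : H ⊆ Set.range truthSet) (hH : JoinClosed Q H)
    (hG : ∀ s ∈ H, guardInterp Q S s ∈ G) :
    StepCond Θ Q S (inclusionRel U₁ U₂ G) (inclusionRel U₁ U₂ H) := by
  cases Q
  · exact ⟨back_memLE h₁ hdef hH hG, back_memLE h₂ hdef hH hG⟩
  · exact ⟨forth_memLE h₂ hdef hH hG, forth_memLE h₁ hdef hH hG⟩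

end InclusionRel

/-! ### Inclusion relations obtained from connectives -/

/-- The last components of the tuples in `[μ](β)`. -/
def connEnds (Θ : Set ℕ) {U₁ U₂ : Type*} [(corrLang Θ).Structure U₁] [(corrLang Θ).Structure U₂]
    {k : ℕ} (β : Set (BiRel U₁ U₂)) (μ : PreConn k) : Set (BiRel U₁ U₂) :=
  (fun t => t (Fin.last _)) '' connOp Θ β μ

section ConnEnds

variable {Θ : Set ℕ} {U₁ U₂ : Type*} [(corrLang Θ).Structure U₁] [(corrLang Θ).Structure U₂]
  {k m : ℕ} {Q : Quant} {S : Fin (m + 1) → ℕ} {β : Set (BiRel U₁ U₂)} {μ : PreConn k}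
  {A B : BiRel U₁ U₂}

theorem exists_init_eq_and_last_eq {α : Type*} {n : ℕ} (s : Fin n → α) (a : α) :
    ∃ t : Fin (n + 1) → α, Fin.init t = s ∧ t (Fin.last n) = a :=
  ⟨Fin.snoc (α := fun _ => α) s a, Fin.init_snoc .., Fin.snoc_last ..⟩

theorem mem_connEnds_core {b : BoolComb k} (hA : A ∈ boolOp b.eval β) :
    A ∈ connEnds Θ β (.core b) :=
  ⟨fun _ => A, hA, rfl⟩

theorem mem_connEnds_guard_of_isSpecial (hμ : (PreConn.guard Q m S μ).IsSpecial) (hB : B ∈ β)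
    (hstep : SpecialStepCond Θ Q S A B) : A ∈ connEnds Θ β (.guard Q m S μ) := by
  obtain ⟨t, hinit, rfl⟩ := exists_init_eq_and_last_eq (fun _ : Fin (μ.degree + 1) => B) A
  obtain rfl : t (Fin.last _).castSucc = B := congrFun hinit _
  exact ⟨t, ⟨fun _ => ⟨hB, hstep⟩, fun h => (h hμ).elim⟩, rfl⟩

theorem mem_connEnds_guard_of_not_isSpecial (hμ : ¬ (PreConn.guard Q m S μ).IsSpecial)
    (hB : B ∈ connEnds Θ β μ) (hstep : StepCond Θ Q S A B) :
    A ∈ connEnds Θ β (.guard Q m S μ) := by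
  obtain ⟨t, ht, rfl⟩ := hB
  obtain ⟨t, rfl, rfl⟩ := exists_init_eq_and_last_eq t A
  exact ⟨t, ⟨fun h => (hμ h).elim, fun _ => ⟨ht, hstep⟩⟩, rfl⟩

end ConnEnds

section InclusionConn

variable {Θ : Set ℕ} {U₁ U₂ : Type u} [(corrLang Θ).Structure U₁] [(corrLang Θ).Structure U₂]
  {k m : ℕ} {f : (Fin k → Bool) → Bool} {b : BoolComb k} {Q : Quant} {S : Fin (m + 1) → ℕ}
  {L G : Set (Set (PointedModel.{u} Θ))}

theorem boolImage_subset_range_truthSet (hdef : L ⊆ Set.range truthSet) :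
    boolImage b.eval L ⊆ Set.range truthSet := by
  rintro _ ⟨ψ, hψ, rfl⟩
  choose χ hχ using fun i => hdef (hψ i)
  exact ⟨b.apply χ, by rw [truthSet_boolComb, funext hχ]⟩

theorem inclusionRel_mem_boolOp (hL : IsBoundedSublattice L) (hf : boolImage f L ⊆ L) :
    inclusionRel U₁ U₂ L ∈ boolOp f {inclusionRel U₁ U₂ L} := by
  have inv_eq : ¬ Monotone f → (inclusionRel U₁ U₂ L).inv = inclusionRel U₁ U₂ L := by
    intro hm
    have compl_image_subset := (compl_image_subset_boolImage_of_not_monotone hL hm).trans hf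
    rw [← inclusionRel_compl_image, compl_image_subset.antisymm fun s hs =>
      ⟨sᶜ, compl_image_subset ⟨s, hs, rfl⟩, compl_compl s⟩]
  unfold boolOp
  split_ifs with hc hm ha
  · trivial
  · rfl
  · exact ⟨_, rfl, inv_eq hm⟩
  · refine ⟨_, rfl, ?_⟩
    dsimp only
    rw [inv_eq hm]
    exact BiRel.ext (funext₂ fun _ _ => and_self _) (funext₂ fun _ _ => and_self _)

theorem exists_inclusionRel_mem_boolOp (hL : IsBoundedSublattice L) (hf : ¬ SpecialFn Q f)
    (hconst : IsConstantFn f → Q.unit ∈ boolImage f L) :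
    ∃ H ⊆ boolImage f L, JoinClosed Q H ∧
      inclusionRel U₁ U₂ H ∈ boolOp f {inclusionRel U₁ U₂ L} := by
  unfold boolOp
  split_ifs with hc hm ha
  · refine ⟨{Q.unit}, Set.singleton_subset_iff.2 (hconst hc), ⟨rfl, ?_⟩, trivial⟩
    rintro _ _ rfl rfl
    exact Q.join_unit _
  · exact ⟨L, (boolImage_eq_of_monotone hL hm hc).ge, hL.joinClosed, rfl⟩
  · exact ⟨compl '' L, (boolImage_eq_of_antitone hL ha hc).ge, hL.compl_image.joinClosed,
      _, rfl, inclusionRel_compl_image.symm⟩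
  · refine ⟨Set.image2 Q.join L (compl '' L),
      image2_join_subset_boolImage hL fun hw => hf ⟨⟨hm, ha⟩, hw⟩,
      hL.joinClosed.image2_join hL.compl_image.joinClosed, _, rfl, ?_⟩
    rw [inclusionRel_image2_join hL.joinClosed.unit_mem hL.compl_image.joinClosed.unit_mem,
      inclusionRel_compl_image]

theorem inclusionRel_mem_connEnds_guard_core (h₁ : PathSaturated Θ U₁) (h₂ : PathSaturated Θ U₂)
    (hL : IsBoundedSublattice L) (hdef : L ⊆ Set.range truthSet)
    (hconst : IsConstantFn b.eval → Q.unit ∈ boolImage b.eval L)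
    (hG : ∀ s ∈ boolImage b.eval L, guardInterp Q S s ∈ G) :
    inclusionRel U₁ U₂ G ∈ connEnds Θ {inclusionRel U₁ U₂ L} (.guard Q m S (.core b)) := by
  have stepCond : ∀ H ⊆ boolImage b.eval L, JoinClosed Q H →
      StepCond Θ Q S (inclusionRel U₁ U₂ G) (inclusionRel U₁ U₂ H) := fun H hH hjoin =>
    stepCond_inclusionRel h₁ h₂ (hH.trans (boolImage_subset_range_truthSet hdef)) hjoin
      fun s hs => hG s (hH hs)
  by_cases hspecial : SpecialFn Q b.eval
  · refine mem_connEnds_guard_of_isSpecial hspecial rfl ⟨?_, ?_⟩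
    · exact stepCond L (subset_boolImage_of_not_antitone hL hspecial.1.2) hL.joinClosed
    · rw [← inclusionRel_compl_image]
      exact stepCond _ (compl_image_subset_boolImage_of_not_monotone hL hspecial.1.1)
        hL.compl_image.joinClosed
  · obtain ⟨H, hH, hjoin, hmem⟩ :=
      exists_inclusionRel_mem_boolOp (U₁ := U₁) (U₂ := U₂) hL hspecial hconst
    exact mem_connEnds_guard_of_not_isSpecial hspecial (mem_connEnds_core hmem)
      (stepCond H hH hjoin)

/-- Weak speciality makes the guarded sets closed under the joins of the outer quantifier. -/
theorem inclusionRel_mem_connEnds_guard_guard_core (h₁ : PathSaturated Θ U₁)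
    (h₂ : PathSaturated Θ U₂) (hL : IsBoundedSublattice L) (hdef : L ⊆ Set.range truthSet)
    (hc : ¬ IsConstantFn b.eval) (hweak : WeaklySpecialFn Q.dual b.eval) {m' : ℕ}
    {S' : Fin (m' + 1) → ℕ}
    (hG : ∀ s ∈ boolImage b.eval L, guardInterp Q S (guardInterp Q.dual S' s) ∈ G) :
    inclusionRel U₁ U₂ G ∈
      connEnds Θ {inclusionRel U₁ U₂ L} (.guard Q m S (.guard Q.dual m' S' (.core b))) := by
  have inner_def : guardInterp Q.dual S' '' boolImage b.eval L ⊆ Set.range truthSet := by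
    rintro _ ⟨s, hs, rfl⟩
    obtain ⟨φ, rfl⟩ := boolImage_subset_range_truthSet hdef hs
    exact ⟨_, truthSet_guardFormula Q.dual S' φ⟩
  have inner_mem : inclusionRel U₁ U₂ (guardInterp Q.dual S' '' boolImage b.eval L) ∈
      connEnds Θ {inclusionRel U₁ U₂ L} (.guard Q.dual m' S' (.core b)) :=
    inclusionRel_mem_connEnds_guard_core h₁ h₂ hL hdef (fun h => (hc h).elim)
      fun s hs => ⟨s, hs, rfl⟩
  refine mem_connEnds_guard_of_not_isSpecial id inner_mem
    (stepCond_inclusionRel h₁ h₂ inner_def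
      (joinClosed_boolImage hL hweak hc).guardInterp_image ?_)
  rintro _ ⟨s, hs, rfl⟩
  exact hG s hs

theorem inclusionRel_mem_connEnds {μ : PreConn k} (hμ : μ.IsGuardedConnective)
    (hdeg : μ.IsFlat ∨ μ.IsRegular ∧ μ.degree = 2) (h₁ : PathSaturated Θ U₁)
    (h₂ : PathSaturated Θ U₂) (hL : IsBoundedSublattice L) (hdef : L ⊆ Set.range truthSet)
    (hclosed : ∀ ψ : Fin k → Set (PointedModel.{u} Θ), (∀ i, ψ i ∈ L) → μ.interp ψ ∈ L) :
    inclusionRel U₁ U₂ L ∈ connEnds Θ {inclusionRel U₁ U₂ L} μ := by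
  match μ with
  | .core b =>
    refine mem_connEnds_core (inclusionRel_mem_boolOp hL ?_)
    rintro _ ⟨ψ, hψ, rfl⟩
    exact hclosed ψ hψ
  | .guard Q m S (.core b) =>
    refine inclusionRel_mem_connEnds_guard_core h₁ h₂ hL hdef
      (fun hc => hμ.unit_mem_boolImage hc ⟨⊥, hL.bot_mem⟩) ?_
    rintro _ ⟨ψ, hψ, rfl⟩
    exact hclosed ψ hψ
  | .guard Q m S (.guard Q' m' S' (.core b)) =>
    obtain hflat | ⟨⟨⟨ν, hν, -, hweak⟩, hc⟩, -⟩ := hdeg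
    · simp [PreConn.IsFlat, PreConn.degree] at hflat
    have hweak' : WeaklySpecialFn Q' b.eval := by
      obtain rfl | rfl | rfl := hν
      exacts [hweak.elim, hweak, hweak.elim]
    rw [PreConn.IsGuardedConnective] at hμ
    obtain rfl := Quant.eq_dual_of_ne hμ.2.1
    refine inclusionRel_mem_connEnds_guard_guard_core h₁ h₂ hL hdef hc hweak' ?_
    rintro _ ⟨ψ, hψ, rfl⟩
    exact hclosed ψ hψ
  | .guard _ _ _ (.guard _ _ _ (.guard _ _ _ μ)) =>
    obtain hflat | ⟨-, h2⟩ := hdeg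
    · simp [PreConn.IsFlat, PreConn.degree] at hflat
    · simp [PreConn.degree] at h2

end InclusionConn

/-! ### The truth sets of a fragment -/

section FragmentSets

variable {Θ : Set ℕ} {𝕄 : Set Conn}

/-- The truth sets of the formulas of the fragment generated by `𝕄`. -/
def fragmentSets (Θ : Set ℕ) (𝕄 : Set Conn) : Set (Set (PointedModel.{u} Θ)) :=
  truthSet '' {ψ | Fragment Θ 𝕄 ψ}

theorem fragmentSets_subset_range_truthSet :
    fragmentSets.{u} Θ 𝕄 ⊆ Set.range truthSet :=
  Set.image_subset_range _ _

theorem truthSet_mem_fragmentSets {φ : CorrFormula Θ} :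
    truthSet.{u} φ ∈ fragmentSets Θ 𝕄 ↔ ∃ ψ, Fragment Θ 𝕄 ψ ∧ φ ⇔[∅] ψ :=
  exists_congr fun _ => and_congr_right fun _ => eq_comm.trans truthSet_eq_iff

theorem interp_mem_fragmentSets {μ : Conn} (hμ : μ ∈ 𝕄)
    {ψ : Fin μ.1 → Set (PointedModel.{u} Θ)} (hψ : ∀ i, ψ i ∈ fragmentSets Θ 𝕄) :
    μ.2.interp ψ ∈ fragmentSets Θ 𝕄 := by
  choose χ hχ h using hψ
  exact ⟨_, .app μ hμ χ hχ, by rw [truthSet_apply, funext h]⟩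

theorem ContainsConn.interp_mem_fragmentSets {k : ℕ} {ν : PreConn k}
    (hν : ContainsConn 𝕄 ⟨k, ν⟩) {ψ : Fin k → Set (PointedModel.{u} Θ)}
    (hψ : ∀ i, ψ i ∈ fragmentSets Θ 𝕄) : ν.interp ψ ∈ fragmentSets Θ 𝕄 := by
  obtain ⟨⟨k, μ⟩, hμ, rfl, hequiv⟩ := hν
  rw [← hequiv.interp_eq]
  exact _root_.interp_mem_fragmentSets hμ hψ

theorem isBoundedSublattice_fragmentSets (hand : ContainsConn 𝕄 connAnd)
    (hor : ContainsConn 𝕄 connOr) (hbot : ContainsConn 𝕄 connBot)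
    (htop : ContainsConn 𝕄 connTop) : IsBoundedSublattice (fragmentSets.{u} Θ 𝕄) where
  supClosed s hs t ht := by
    convert hor.interp_mem_fragmentSets (ψ := ![s, t]) (by simp [Fin.forall_fin_two, hs, ht])
    ext p
    simp [PreConn.interp, BoolComb.eval]
  infClosed s hs t ht := by
    convert hand.interp_mem_fragmentSets (ψ := ![s, t]) (by simp [Fin.forall_fin_two, hs, ht])
    ext p
    simp [PreConn.interp, BoolComb.eval]
  bot_mem := by
    convert hbot.interp_mem_fragmentSets (ψ := Fin.elim0) fun i => i.elim0
    ext p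
    simp [PreConn.interp, BoolComb.eval]
  top_mem := by
    convert htop.interp_mem_fragmentSets (ψ := Fin.elim0) fun i => i.elim0
    ext p
    simp [PreConn.interp, BoolComb.eval]

theorem isAsimulation_inclusionRel {U₁ U₂ : Type u} [(corrLang Θ).Structure U₁]
    [(corrLang Θ).Structure U₂] (h₁ : PathSaturated Θ U₁) (h₂ : PathSaturated Θ U₂)
    (h𝕄 : ∀ μ ∈ 𝕄, μ.2.IsGuardedConnective ∧
      (μ.2.IsFlat ∨ (μ.2.IsRegular ∧ μ.2.degree = 2)))
    (hL : IsBoundedSublattice (fragmentSets.{u} Θ 𝕄))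
    (hne : (inclusionRel U₁ U₂ (fragmentSets Θ 𝕄)).IsNonempty) :
    IsAsimulation Θ 𝕄 (inclusionRel U₁ U₂ (fragmentSets Θ 𝕄)) := by
  refine ⟨hne, fun n => ?_, fun μ hμ => ?_⟩
  · have atom_mem : truthSet (atomP n) ∈ fragmentSets Θ 𝕄 := ⟨_, .atom n, rfl⟩
    exact ⟨fun _ _ h => h _ atom_mem, fun _ _ h => h _ atom_mem⟩
  · exact inclusionRel_mem_connEnds (h𝕄 μ hμ).1 (h𝕄 μ hμ).2 h₁ h₂ hL
      fragmentSets_subset_range_truthSet fun ψ hψ => interp_mem_fragmentSets hμ hψ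

end FragmentSets

section Separation

variable {Θ : Set ℕ} {φ : CorrFormula Θ} {C L : Set (Set (PointedModel.{u} Θ))}

theorem exists_pathSaturated_mem_truthSet (hdef : C ⊆ Set.range truthSet)
    (hC : JoinClosed .ex C) (h : ∀ s ∈ C, (s ⊓ truthSet φ).Nonempty) :
    ∃ p : PointedModel.{u} Θ, PathSaturated Θ p.Carrier ∧ p ∈ truthSet φ ∧ ∀ s ∈ C, p ∈ s := by
  have inf_def : (· ⊓ truthSet φ) '' C ⊆ Set.range truthSet := by
    rintro _ ⟨s, hs, rfl⟩
    obtain ⟨ψ, rfl⟩ := hdef hs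
    exact ⟨ψ ⊓ φ, truthSet_inf ψ φ⟩
  have directed : DirectedOn (· ≥ ·) ((· ⊓ truthSet φ) '' C) := by
    rintro _ ⟨s, hs, rfl⟩ _ ⟨t, ht, rfl⟩
    exact ⟨_, ⟨s ⊓ t, hC.join_mem hs ht, rfl⟩, inf_le_inf_right _ inf_le_left,
      inf_le_inf_right _ inf_le_right⟩
  obtain ⟨p, hp, hmem⟩ := exists_pathSaturated_forall_mem inf_def ⟨_, _, hC.unit_mem, rfl⟩
    directed (Set.forall_mem_image.2 h)
  exact ⟨p, hp, (hmem _ ⟨_, hC.unit_mem, rfl⟩).2, fun s hs => (hmem _ ⟨s, hs, rfl⟩).1⟩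

theorem exists_pathSaturated_memLE (hL : IsBoundedSublattice L) (hdef : L ⊆ Set.range truthSet)
    (hφ : truthSet φ ∉ L) :
    ∃ p q : PointedModel.{u} Θ, PathSaturated Θ p.Carrier ∧ PathSaturated Θ q.Carrier ∧
      p ∈ truthSet φ ∧ q ∉ truthSet φ ∧ MemLE L p q := by
  have supersets : JoinClosed .ex {s ∈ L | truthSet φ ⊆ s} :=
    ⟨⟨hL.top_mem, Set.subset_univ _⟩,
      fun hs ht => ⟨hL.infClosed hs.1 ht.1, Set.subset_inter hs.2 ht.2⟩⟩
  obtain ⟨q, hq, hqφ, hq_mem⟩ := exists_pathSaturated_mem_truthSet (φ := φ.not)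
    ((Set.sep_subset _ _).trans hdef) supersets <| by
      rintro s ⟨hs, hφs⟩
      rw [truthSet_not]
      exact Set.inter_compl_nonempty_iff.2 fun hsφ => hφ (hφs.antisymm hsφ ▸ hs)
  obtain ⟨p, hp, hpφ, hp_mem⟩ := exists_pathSaturated_mem_truthSet (φ := φ)
    (compl_image_subset_range_truthSet ((Set.sep_subset _ _).trans hdef))
    ((hL.joinClosed.sep_notMem q).compl_image) <| by
      rintro _ ⟨s, ⟨hs, hqs⟩, rfl⟩
      rw [inf_comm]
      exact Set.inter_compl_nonempty_iff.2 fun hφs => hqs (hq_mem s ⟨hs, hφs⟩)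
  rw [truthSet_not] at hqφ
  refine ⟨p, q, hp, hq, hpφ, hqφ, fun s hs hps => ?_⟩
  by_contra hqs
  exact hp_mem _ ⟨s, ⟨hs, hqs⟩, rfl⟩ hps

end Separation

theorem theorem1_general (Θ : Set ℕ) (𝕄 : Set Conn)
    (h𝕄 : ∀ μ ∈ 𝕄, μ.2.IsGuardedConnective ∧
      (μ.2.IsFlat ∨ (μ.2.IsRegular ∧ μ.2.degree = 2)))
    (hand : ContainsConn 𝕄 connAnd) (hor : ContainsConn 𝕄 connOr)
    (hbot : ContainsConn 𝕄 connBot) (htop : ContainsConn 𝕄 connTop) (φ : CorrFormula Θ) :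
    (∃ ψ : CorrFormula Θ, Fragment Θ 𝕄 ψ ∧ (∅ : (corrLang Θ).Theory).Iff φ ψ) ↔
      InvariantUnderAsimulations.{u} 𝕄 φ := by
  have hL := isBoundedSublattice_fragmentSets (Θ := Θ) hand hor hbot htop
  rw [← truthSet_mem_fragmentSets.{u}]
  constructor
  · rintro ⟨ψ, hψ, htruth⟩ U₁ U₂ _ _ _ _ A hA
    have hpreserves := Fragment.preserves hψ hA
    rwa [htruth] at hpreserves
  · intro hinv
    by_contra hφ
    obtain ⟨p, q, hp, hq, hpφ, hqφ, hpq⟩ :=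
      exists_pathSaturated_memLE hL fragmentSets_subset_range_truthSet hφ
    have : Nonempty p.Carrier := ⟨p.pt⟩
    have : Nonempty q.Carrier := ⟨q.pt⟩
    have hA := isAsimulation_inclusionRel hp hq h𝕄 hL (.inl ⟨p.pt, q.pt, hpq⟩)
    exact hqφ ((hinv _ _ _ hA).1 p.pt q.pt hpq hpφ)

theorem theorem1 (Θ : Set ℕ) (𝕄 : Set Conn) (hstd : IsStandard 𝕄)
    (hand : ContainsConn 𝕄 connAnd) (hor : ContainsConn 𝕄 connOr)
    (hbot : ContainsConn 𝕄 connBot) (htop : ContainsConn 𝕄 connTop)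
    (φ : CorrFormula Θ) (hφ : IdentityFree φ) :
    (∃ ψ : CorrFormula Θ, Fragment Θ 𝕄 ψ ∧ (∅ : (corrLang Θ).Theory).Iff φ ψ) ↔
      InvariantUnderAsimulations.{u} 𝕄 φ :=
  theorem1_general Θ 𝕄 hstd.2 hand hor hbot htop φ
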